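/- Let $(M,\kappa)$ be a symplectic manifold of dimension $2n$, that is, a smooth manifold with a smooth, closed, non-degenerate 2-form $\kappa$, and let $J$ be a $\kappa$-calibrated almost complex structure: a smooth section $J$ of $\mathrm{End}(TM)$ with $J^2=-\mathrm{Id}$, $\kappa(J\cdot,J\cdot)=\kappa(\cdot,\cdot)$, and such that $g(\cdot,\cdot):=\kappa(J\cdot,\cdot)$ is positive definite. Let $\nabla$ be the Levi-Civita connection of the Riemannian metric $g$; extend $g$ complex-bilinearly, and $J$ and $\nabla$ complex-linearly (the latter in both arguments), to $TM\otimes\mathbb{C}$, and let $TM^{(1,0)}$ and $TM^{(0,1)}$ be the eigenbundles of $J$ in $TM\otimes\mathbb{C}$ for the eigenvalues $i$ and $-i$. Then for every point $o\in M$ there are an open neighbourhood $U$ of $o$ and smooth complex vector fields $W_1,\dots,W_n$ on $U$ which form a basis of $T_xM^{(1,0)}$ at every $x\in U$, such that: 1. $\nabla_{W_k}\overline{W}_i(o)=0$ for $1\le k,i\le n$; 2. $\nabla_{W_k}W_i(o)\in T_oM^{(0,1)}$ for $1\le k,i\le n$; 3. if $G_{rs}:=g(W_r,\overline{W}_s)$,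 then $G_{rs}(o)=\delta_{rs}$ and $dG_{rs}(o)=0$ for $1\le r,s\le n$; 4. $\nabla_{W_r}\nabla_{\overline{W}_k}W_i(o)=0$ for $1\le r,k,i\le n$. -/

import Mathlib

open Bundle Module
open scoped Manifold ContDiff TensorProduct

set_option linter.unusedSectionVars false

namespace AlmostKahler

noncomputable section

section LeviCivita

variable {E : Type*} [NormedAddCommGroup E] [NormedSpace ℝ E] [FiniteDimensional ℝ E]
  {M : Type*} [TopologicalSpace M] [ChartedSpace E M] [IsManifold 𝓘(ℝ, E) ∞ M]

/-- A smooth Riemannian metric on `M`. -/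
abbrev SmoothMetric (E : Type*) [NormedAddCommGroup E] [NormedSpace ℝ E]
    (M : Type*) [TopologicalSpace M] [ChartedSpace E M] [IsManifold 𝓘(ℝ, E) ∞ M] :=
  ContMDiffRiemannianMetric 𝓘(ℝ, E) ∞ E (fun x : M ↦ TangentSpace 𝓘(ℝ, E) x)

variable (g : SmoothMetric E M)

lemma mdiffAt_metric {X Y : Π x : M, TangentSpace 𝓘(ℝ, E) x} {x : M}
    (hX : MDiffAt (T% X) x) (hY : MDiffAt (T% Y) x) :
    MDiffAt (fun y ↦ g.inner y (X y) (Y y)) x := by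
  have h := MDifferentiableAt.clm_bundle_apply₂ (F₁ := E) (F₂ := E) (F₃ := ℝ)
    (E₃ := Bundle.Trivial M ℝ)
    ((g.contMDiff x).mdifferentiableAt (by simp)) hX hY
  simp only [mdifferentiableAt_totalSpace] at h
  exact h.2

/-- The right-hand side of the Koszul formula for `2 g(∇_X Y, Z)`. -/
def koszul (X Y Z : Π x : M, TangentSpace 𝓘(ℝ, E) x) (x : M) : ℝ :=
  d% (fun y ↦ g.inner y (Y y) (Z y)) x (X x)
  + d% (fun y ↦ g.inner y (X y) (Z y)) x (Y x)
  - d% (fun y ↦ g.inner y (X y) (Y y)) x (Z x)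
  + g.inner x (VectorField.mlieBracket 𝓘(ℝ, E) X Y x) (Z x)
  - g.inner x (VectorField.mlieBracket 𝓘(ℝ, E) X Z x) (Y x)
  - g.inner x (VectorField.mlieBracket 𝓘(ℝ, E) Y Z x) (X x)

lemma dmetric_add_left {X X' Y : Π x : M, TangentSpace 𝓘(ℝ, E) x} {x : M}
    (hX : MDiffAt (T% X) x) (hX' : MDiffAt (T% X') x) (hY : MDiffAt (T% Y) x) :
    d% (fun y ↦ g.inner y ((X + X') y) (Y y)) x = d% (fun y ↦ g.inner y (X y) (Y y)) x
      + d% (fun y ↦ g.inner y (X' y) (Y y)) x := by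
  simp only [Pi.add_apply, map_add, add_apply]
  exact mvfderiv_fun_add (mdiffAt_metric g hX hY) (mdiffAt_metric g hX' hY)

lemma dmetric_smul_left {X Y : Π x : M, TangentSpace 𝓘(ℝ, E) x} {f : M → ℝ} {x : M}
    (hf : MDiffAt f x) (hX : MDiffAt (T% X) x) (hY : MDiffAt (T% Y) x)
    (v : TangentSpace 𝓘(ℝ, E) x) :
    d% (fun y ↦ g.inner y ((f • X) y) (Y y)) x v = f x * d% (fun y ↦ g.inner y (X y) (Y y)) x v
      + g.inner x (X x) (Y x) * d% f x v := by
  simp only [Pi.smul_apply', map_smul, smul_apply, smul_eq_mul]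
  rw [mvfderiv_fun_mul hf (mdiffAt_metric g hX hY)]
  simp

lemma metric_comm (X Y : Π x : M, TangentSpace 𝓘(ℝ, E) x) :
    (fun y ↦ g.inner y (X y) (Y y)) = fun y ↦ g.inner y (Y y) (X y) := by
  ext y; exact g.symm y _ _


lemma dmetric_add_right {X Y Y' : Π x : M, TangentSpace 𝓘(ℝ, E) x} {x : M}
    (hX : MDiffAt (T% X) x) (hY : MDiffAt (T% Y) x) (hY' : MDiffAt (T% Y') x) :
    d% (fun y ↦ g.inner y (X y) ((Y + Y') y)) x = d% (fun y ↦ g.inner y (X y) (Y y)) x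
      + d% (fun y ↦ g.inner y (X y) (Y' y)) x := by
  rw [metric_comm g X, metric_comm g X Y, metric_comm g X Y', dmetric_add_left g hY hY' hX]

lemma dmetric_smul_right {X Y : Π x : M, TangentSpace 𝓘(ℝ, E) x} {f : M → ℝ} {x : M}
    (hf : MDiffAt f x) (hX : MDiffAt (T% X) x) (hY : MDiffAt (T% Y) x)
    (v : TangentSpace 𝓘(ℝ, E) x) :
    d% (fun y ↦ g.inner y (X y) ((f • Y) y)) x v = f x * d% (fun y ↦ g.inner y (X y) (Y y)) x v
      + g.inner x (X x) (Y x) * d% f x v := by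
  rw [metric_comm g X, metric_comm g X Y, dmetric_smul_left g hf hY hX, g.symm x (Y x)]

variable {X X' Y Y' Z Z' : Π x : M, TangentSpace 𝓘(ℝ, E) x} {f : M → ℝ} {x : M}

lemma koszul_tensorial_left (hY : MDiffAt (T% Y) x) (hZ : MDiffAt (T% Z) x) :
    TensorialAt 𝓘(ℝ, E) E (fun X ↦ koszul g X Y Z x) x where
  smul {f X} hf hX := by
    simp only [koszul, dmetric_smul_left g hf hX hZ, dmetric_smul_left g hf hX hY]
    simp only [VectorField.mlieBracket_smul_left hf hX, map_add, map_smul, add_apply, smul_apply,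
      smul_eq_mul, Pi.smul_apply', map_neg, neg_smul, neg_apply]
    rw [g.symm x (VectorField.mlieBracket _ Y Z x)]
    ring
  add {X X'} hX hX' := by
    simp only [koszul, dmetric_add_left g hX hX' hZ, dmetric_add_left g hX hX' hY]
    simp only [VectorField.mlieBracket_add_left hX hX', map_add, add_apply, Pi.add_apply]
    ring

lemma koszul_tensorial_right (hX : MDiffAt (T% X) x) (hY : MDiffAt (T% Y) x) :
    TensorialAt 𝓘(ℝ, E) E (fun Z ↦ koszul g X Y Z x) x where
  smul {f Z} hf hZ := by
    simp only [koszul, dmetric_smul_right g hf hX hZ, dmetric_smul_right g hf hY hZ]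
    simp only [VectorField.mlieBracket_smul_right hf hZ, map_add, map_smul, add_apply, smul_apply,
      smul_eq_mul, Pi.smul_apply']
    rw [g.symm x (Z x) (X x), g.symm x (Z x) (Y x)]
    ring
  add {Z Z'} hZ hZ' := by
    simp only [koszul, dmetric_add_right g hX hZ hZ', dmetric_add_right g hY hZ hZ']
    simp only [VectorField.mlieBracket_add_right hZ hZ', map_add, add_apply, Pi.add_apply]
    ring

lemma koszul_add_mid (hX : MDiffAt (T% X) x) (hY : MDiffAt (T% Y) x) (hY' : MDiffAt (T% Y') x)
    (hZ : MDiffAt (T% Z) x) :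
    koszul g X (Y + Y') Z x = koszul g X Y Z x + koszul g X Y' Z x := by
  simp only [koszul, dmetric_add_right g hX hY hY', dmetric_add_left g hY hY' hZ]
  simp only [VectorField.mlieBracket_add_right hY hY', VectorField.mlieBracket_add_left hY hY',
    map_add, add_apply, Pi.add_apply]
  ring

lemma koszul_smul_mid (hf : MDiffAt f x) (hX : MDiffAt (T% X) x) (hY : MDiffAt (T% Y) x)
    (hZ : MDiffAt (T% Z) x) :
    koszul g X (f • Y) Z x = f x * koszul g X Y Z x
      + 2 * (d% f x (X x) * g.inner x (Y x) (Z x)) := by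
  simp only [koszul, dmetric_smul_right g hf hX hY, dmetric_smul_left g hf hY hZ]
  simp only [VectorField.mlieBracket_smul_right hf hY, VectorField.mlieBracket_smul_left hf hY,
    map_add, map_smul, add_apply, smul_apply,
    smul_eq_mul, Pi.smul_apply', map_neg, neg_smul, neg_apply]
  rw [g.symm x (Y x) (X x)]
  ring

lemma metric_neg_left (v w : TangentSpace 𝓘(ℝ, E) x) :
    g.inner x (-v) w = -g.inner x v w := by
  rw [map_neg]; rfl

lemma metric_ext {v w : TangentSpace 𝓘(ℝ, E) x} (h : ∀ u, g.inner x v u = g.inner x w u) :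
    v = w := by
  by_contra hne
  have := g.pos x (v - w) (sub_ne_zero.2 hne)
  have h' : g.inner x (v - w) (v - w) = g.inner x v (v - w) - g.inner x w (v - w) := by
    rw [map_sub (g.inner x)]; rfl
  rw [h', h, sub_self] at this
  exact lt_irrefl _ this

lemma exists_koszul_cov (Y : Π x : M, TangentSpace 𝓘(ℝ, E) x) (x : M) :
    ∃ A : TangentSpace 𝓘(ℝ, E) x →L[ℝ] TangentSpace 𝓘(ℝ, E) x, MDiffAt (T% Y) x →
      ∀ X Z : Π x : M, TangentSpace 𝓘(ℝ, E) x, MDiffAt (T% X) x → MDiffAt (T% Z) x →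
        2 * g.inner x (A (X x)) (Z x) = koszul g X Y Z x := by
  by_cases hY : MDiffAt (T% Y) x
  swap
  · exact ⟨0, fun h ↦ absurd h hY⟩
  have : FiniteDimensional ℝ (TangentSpace 𝓘(ℝ, E) x) := inferInstanceAs (FiniteDimensional ℝ E)
  have : T2Space (TangentSpace 𝓘(ℝ, E) x) := inferInstanceAs (T2Space E)
  let K := TensorialAt.mkHom₂ (I := 𝓘(ℝ, E)) (F := E) (F' := E) (fun X Z ↦ koszul g X Y Z x) x
    (fun Z hZ ↦ koszul_tensorial_left g hY hZ) (fun X hX ↦ koszul_tensorial_right g hX hY)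
  let B : LinearMap.BilinForm ℝ (TangentSpace 𝓘(ℝ, E) x) :=
    LinearMap.mk₂ ℝ (fun v w ↦ g.inner x v w) (by simp) (by simp) (by simp) (by simp)
  let K' : LinearMap.BilinForm ℝ (TangentSpace 𝓘(ℝ, E) x) :=
    LinearMap.mk₂ ℝ (fun v w ↦ (1 / 2) * K v w) (by intros; simp; ring) (by intros; simp; ring)
      (by intros; simp; ring) (by intros; simp; ring)
  have hB : B.Nondegenerate := by
    refine ⟨fun v hv ↦ metric_ext g fun u ↦ ?_, fun v hv ↦ metric_ext g fun u ↦ ?_⟩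
    · simpa [B] using hv u
    · have := hv u
      simp only [B, LinearMap.mk₂_apply] at this
      rw [g.symm, this]; simp
  refine ⟨LinearMap.toContinuousLinearMap ((B.toDual hB).symm.toLinearMap ∘ₗ K'),
    fun _ X Z hX hZ ↦ ?_⟩
  have h1 := LinearMap.BilinForm.apply_toDual_symm_apply (hB := hB) (K' (X x)) (Z x)
  have h2 : K (X x) (Z x) = koszul g X Y Z x := TensorialAt.mkHom₂_apply _ _ hX hZ
  simp only [B, K', LinearMap.mk₂_apply, h2] at h1
  simp only [LinearMap.coe_toContinuousLinearMap', LinearMap.comp_apply, LinearEquiv.coe_coe]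
  rw [h1]
  ring

/-- `∇` is the Levi-Civita connection of `g`: it is torsion-free and compatible with `g`. -/
structure IsLeviCivita
    (nabla : CovariantDerivative 𝓘(ℝ, E) E (fun x : M ↦ TangentSpace 𝓘(ℝ, E) x)) : Prop where
  torsionFree : ∀ {X Y : Π x : M, TangentSpace 𝓘(ℝ, E) x} {x : M},
    MDiffAt (T% X) x → MDiffAt (T% Y) x →
      nabla Y x (X x) - nabla X x (Y x) = VectorField.mlieBracket 𝓘(ℝ, E) X Y x
  metric : ∀ {Y Z : Π x : M, TangentSpace 𝓘(ℝ, E) x} {x : M} (v : TangentSpace 𝓘(ℝ, E) x),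
    MDiffAt (T% Y) x → MDiffAt (T% Z) x →
      d% (fun y ↦ g.inner y (Y y) (Z y)) x v =
        g.inner x (nabla Y x v) (Z x) + g.inner x (Y x) (nabla Z x v)

theorem exists_isLeviCivita :
    ∃ nabla : CovariantDerivative 𝓘(ℝ, E) E (fun x : M ↦ TangentSpace 𝓘(ℝ, E) x),
      IsLeviCivita g nabla := by
  choose cov hcov using exists_koszul_cov g
  have hext (x : M) (v : TangentSpace 𝓘(ℝ, E) x) :
      ∃ X : Π x : M, TangentSpace 𝓘(ℝ, E) x, MDiffAt (T% X) x ∧ X x = v :=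
    ⟨FiberBundle.extend E v, FiberBundle.mdifferentiableAt_extend .., by simp⟩
  refine ⟨⟨cov, ⟨?_, ?_⟩⟩, ⟨?_, ?_⟩⟩
  · intro Y Y' x hY hY' _
    ext1 v
    obtain ⟨X, hX, rfl⟩ := hext x v
    refine metric_ext g fun u ↦ ?_
    obtain ⟨Z, hZ, rfl⟩ := hext x u
    have h1 := hcov _ x hY X Z hX hZ
    have h2 := hcov _ x hY' X Z hX hZ
    have h3 := hcov _ x (mdifferentiableAt_add_section hY hY') X Z hX hZ
    rw [koszul_add_mid g hX hY hY' hZ] at h3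
    simp only [add_apply, map_add]
    linarith
  · intro Y f x hY hf _
    ext1 v
    obtain ⟨X, hX, rfl⟩ := hext x v
    refine metric_ext g fun u ↦ ?_
    obtain ⟨Z, hZ, rfl⟩ := hext x u
    have h1 := hcov _ x hY X Z hX hZ
    have h3 := hcov _ x (hf.smul_section hY) X Z hX hZ
    rw [koszul_smul_mid g hf hX hY hZ, ← h1] at h3
    simp only [add_apply, map_add, smul_apply, map_smul, ContinuousLinearMap.smulRight_apply,
      smul_eq_mul]
    linarith
  · intro X Y x hX hY
    refine metric_ext g fun u ↦ ?_
    obtain ⟨Z, hZ, rfl⟩ := hext x u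
    have h1 := hcov _ x hY X Z hX hZ
    have h2 := hcov _ x hX Y Z hY hZ
    simp only [koszul] at h1 h2
    rw [metric_comm g Y X, VectorField.mlieBracket_swap_apply (V := Y) (W := X),
      metric_neg_left g] at h2
    change g.inner x (cov Y x (X x) - cov X x (Y x)) (Z x) = _
    simp only [map_sub, sub_apply]
    linarith
  · intro Y Z x v hY hZ
    obtain ⟨X, hX, rfl⟩ := hext x v
    have h1 := hcov _ x hY X Z hX hZ
    have h2 := hcov _ x hZ X Y hX hY
    simp only [koszul] at h1 h2
    rw [metric_comm g Z Y, VectorField.mlieBracket_swap_apply (V := Z) (W := Y),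
      metric_neg_left g] at h2
    change _ = g.inner x (cov Y x (X x)) (Z x) + g.inner x (Y x) (cov Z x (X x))
    rw [g.symm x (Y x)]
    linarith

/-- The Levi-Civita connection of `g`. Its values on differentiable vector fields are determined by
`IsLeviCivita`, through the Koszul formula. -/
def leviCivita : CovariantDerivative 𝓘(ℝ, E) E (fun x : M ↦ TangentSpace 𝓘(ℝ, E) x) :=
  (exists_isLeviCivita g).choose

lemma isLeviCivita_leviCivita : IsLeviCivita g (leviCivita g) :=
  (exists_isLeviCivita g).choose_spec

end LeviCivita

section Symplectic

variable {E : Type*} [NormedAddCommGroup E] [NormedSpace ℝ E]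
  {M : Type*} [TopologicalSpace M] [ChartedSpace E M]

/-- The value at `x` of the exterior derivative of the 2-form `η` on the vector fields `X, Y, Z`,
by Cartan's invariant formula. -/
def extDerivTwoForm (η : Π x : M, TangentSpace 𝓘(ℝ, E) x →L[ℝ] TangentSpace 𝓘(ℝ, E) x →L[ℝ] ℝ)
    (X Y Z : Π x : M, TangentSpace 𝓘(ℝ, E) x) (x : M) : ℝ :=
  d% (fun y ↦ η y (Y y) (Z y)) x (X x)
  - d% (fun y ↦ η y (X y) (Z y)) x (Y x)
  + d% (fun y ↦ η y (X y) (Y y)) x (Z x)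
  - η x (VectorField.mlieBracket 𝓘(ℝ, E) X Y x) (Z x)
  + η x (VectorField.mlieBracket 𝓘(ℝ, E) X Z x) (Y x)
  - η x (VectorField.mlieBracket 𝓘(ℝ, E) Y Z x) (X x)

variable [IsManifold 𝓘(ℝ, E) ∞ M]

variable (E M) in
/-- A symplectic form on `M`: a smooth, nondegenerate, closed 2-form. -/
structure SymplecticForm where
  form (x : M) : TangentSpace 𝓘(ℝ, E) x →L[ℝ] TangentSpace 𝓘(ℝ, E) x →L[ℝ] ℝ
  smooth : ContMDiff 𝓘(ℝ, E) (𝓘(ℝ, E).prod 𝓘(ℝ, E →L[ℝ] E →L[ℝ] ℝ)) ∞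
    (fun x ↦ TotalSpace.mk' (E →L[ℝ] E →L[ℝ] ℝ) x (form x))
  alternating (x : M) (v : TangentSpace 𝓘(ℝ, E) x) : form x v v = 0
  nondegenerate (x : M) (v : TangentSpace 𝓘(ℝ, E) x) (hv : ∀ w, form x v w = 0) : v = 0
  closed (X Y Z : Π x : M, TangentSpace 𝓘(ℝ, E) x) (x : M) (hX : CMDiffAt ∞ (T% X) x)
    (hY : CMDiffAt ∞ (T% Y) x) (hZ : CMDiffAt ∞ (T% Z) x) : extDerivTwoForm form X Y Z x = 0

/-- An almost complex structure `J` on `M` calibrated by the symplectic form `κ`. -/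
structure CalibratedStructure (κ : SymplecticForm E M) where
  J (x : M) : TangentSpace 𝓘(ℝ, E) x →L[ℝ] TangentSpace 𝓘(ℝ, E) x
  smooth : ContMDiff 𝓘(ℝ, E) (𝓘(ℝ, E).prod 𝓘(ℝ, E →L[ℝ] E)) ∞
    (fun x ↦ TotalSpace.mk' (E →L[ℝ] E) x (J x))
  sq (x : M) (v : TangentSpace 𝓘(ℝ, E) x) : J x (J x v) = -v
  invariant (x : M) (v w : TangentSpace 𝓘(ℝ, E) x) : κ.form x (J x v) (J x w) = κ.form x v w
  pos (x : M) (v : TangentSpace 𝓘(ℝ, E) x) (hv : v ≠ 0) : 0 < κ.form x (J x v) v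

lemma contMDiff_form_comp
    {η : Π x : M, TangentSpace 𝓘(ℝ, E) x →L[ℝ] TangentSpace 𝓘(ℝ, E) x →L[ℝ] ℝ}
    {A : Π x : M, TangentSpace 𝓘(ℝ, E) x →L[ℝ] TangentSpace 𝓘(ℝ, E) x}
    (hη : ContMDiff 𝓘(ℝ, E) (𝓘(ℝ, E).prod 𝓘(ℝ, E →L[ℝ] E →L[ℝ] ℝ)) ∞
      (fun x ↦ TotalSpace.mk' (E →L[ℝ] E →L[ℝ] ℝ) x (η x)))
    (hA : ContMDiff 𝓘(ℝ, E) (𝓘(ℝ, E).prod 𝓘(ℝ, E →L[ℝ] E)) ∞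
      (fun x ↦ TotalSpace.mk' (E →L[ℝ] E) x (A x))) :
    ContMDiff 𝓘(ℝ, E) (𝓘(ℝ, E).prod 𝓘(ℝ, E →L[ℝ] E →L[ℝ] ℝ)) ∞
      (fun x ↦ TotalSpace.mk' (E →L[ℝ] E →L[ℝ] ℝ) x ((η x).comp (A x))) := by
  intro x₀
  have h1 := hη x₀
  have h2 := hA x₀
  rw [contMDiffAt_hom_bundle] at h1 h2 ⊢
  refine ⟨h1.1, (h1.2.clm_comp h2.2).congr_of_eventuallyEq ?_⟩
  filter_upwards [(trivializationAt E (TangentSpace 𝓘(ℝ, E)) x₀).open_baseSet.mem_nhds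
    (FiberBundle.mem_baseSet_trivializationAt' x₀)] with x hx
  ext v w
  simp only [ContinuousLinearMap.inCoordinates, ContinuousLinearMap.comp_apply]
  rw [Trivialization.symmL_continuousLinearMapAt (R := ℝ) _ hx]

lemma isVonNBounded_of_pos [FiniteDimensional ℝ E] (B : E →L[ℝ] E →L[ℝ] ℝ)
    (hB : ∀ v, v ≠ 0 → 0 < B v v) : Bornology.IsVonNBounded ℝ {v : E | B v v < 1} := by
  rw [NormedSpace.isVonNBounded_iff]
  have hcont : Continuous fun v : E ↦ B v v := by fun_prop
  have hcpt : IsCompact (Metric.sphere (0 : E) 1) := isCompact_sphere _ _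
  obtain ⟨c, hc, hmin⟩ : ∃ c > 0, ∀ v ∈ Metric.sphere (0 : E) 1, c ≤ B v v := by
    rcases (Metric.sphere (0 : E) 1).eq_empty_or_nonempty with h | h
    · exact ⟨1, one_pos, by simp [h]⟩
    · obtain ⟨u, hu, hmin⟩ := hcpt.exists_isMinOn h hcont.continuousOn
      refine ⟨B u u, hB u ?_, fun v hv ↦ hmin hv⟩
      rintro rfl
      simp at hu
  refine (Metric.isBounded_iff_subset_closedBall 0).2 ⟨1 + 1 / c, fun v hv ↦ ?_⟩
  rw [mem_closedBall_zero_iff]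
  by_cases hv0 : v = 0
  · rw [hv0, norm_zero]; positivity
  have hn : 0 < ‖v‖ := norm_pos_iff.2 hv0
  have h := hmin (‖v‖⁻¹ • v) (by simp [norm_smul, hn.ne'])
  simp only [map_smul, smul_apply, smul_eq_mul] at h
  have h1 : c * ‖v‖ ^ 2 < 1 := by
    have : c * ‖v‖ ^ 2 ≤ B v v := by
      calc c * ‖v‖ ^ 2 ≤ (‖v‖⁻¹ * (‖v‖⁻¹ * B v v)) * ‖v‖ ^ 2 := by gcongr
        _ = B v v := by field_simp
    exact this.trans_lt hv
  have h2 : ‖v‖ ^ 2 < 1 / c := by rw [lt_div_iff₀ hc]; linarith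
  nlinarith [sq_nonneg (‖v‖ - 1)]

/-- The Riemannian metric `g_J(v, w) = κ(J v, w)`. -/
def CalibratedStructure.metric [FiniteDimensional ℝ E] {κ : SymplecticForm E M}
    (J : CalibratedStructure κ) : SmoothMetric E M where
  inner x := (κ.form x).comp (J.J x)
  symm x v w := by
    have h := κ.alternating x (J.J x w + v)
    have h' := J.invariant x (J.J x v) w
    simp only [map_add, add_apply, κ.alternating, zero_add, add_zero] at h
    simp only [J.sq] at h'
    have h'' : κ.form x (-v) (J.J x w) = - κ.form x v (J.J x w) := by rw [map_neg]; rfl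
    simp only [ContinuousLinearMap.comp_apply]
    linarith
  pos x v hv := J.pos x v hv
  isVonNBounded x := isVonNBounded_of_pos (E := E) ((κ.form x).comp (J.J x)) (J.pos x)
  contMDiff := contMDiff_form_comp κ.smooth J.smooth

end Symplectic

section Complexified

variable {V : Type*} [AddCommGroup V] [Module ℝ V]

/-- The real part `V ⊗ ℂ → V`. -/
def cxRe : ℂ ⊗[ℝ] V →ₗ[ℝ] V := (TensorProduct.lid ℝ V).toLinearMap ∘ₗ Complex.reLm.rTensor V

/-- The imaginary part `V ⊗ ℂ → V`. -/
def cxIm : ℂ ⊗[ℝ] V →ₗ[ℝ] V := (TensorProduct.lid ℝ V).toLinearMap ∘ₗ Complex.imLm.rTensor V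

/-- Complex conjugation on `V ⊗ ℂ`. -/
def cxConj : ℂ ⊗[ℝ] V →ₗ[ℝ] ℂ ⊗[ℝ] V := Complex.conjAe.toLinearMap.rTensor V

variable {E : Type*} [NormedAddCommGroup E] [NormedSpace ℝ E]
  {M : Type*} [TopologicalSpace M] [ChartedSpace E M]

variable (E) in
/-- The complexified tangent space `T_xM ⊗ ℂ`. -/
abbrev CTangent (x : M) : Type _ := ℂ ⊗[ℝ] TangentSpace 𝓘(ℝ, E) x

variable [IsManifold 𝓘(ℝ, E) ∞ M]

/-- A complex vector field is smooth on `U` if its real and imaginary parts are. -/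
def SmoothCFieldOn (W : Π x : M, CTangent E x) (U : Set M) : Prop :=
  CMDiff[U] ∞ (T% (fun x ↦ cxRe (W x))) ∧ CMDiff[U] ∞ (T% (fun x ↦ cxIm (W x)))

/-- The complex-linear extension of a connection: `cxNabla ∇ W x v` is `∇_v W` at `x`, linear over
`ℂ` in `v` and with `∇_v (A + iB) = ∇_v A + i ∇_v B`. -/
def cxNabla (nabla : CovariantDerivative 𝓘(ℝ, E) E (fun x : M ↦ TangentSpace 𝓘(ℝ, E) x))
    (W : Π x : M, CTangent E x) (x : M) : CTangent E x →ₗ[ℂ] CTangent E x :=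
  (nabla (fun y ↦ cxRe (W y)) x).toLinearMap.baseChange ℂ
    + Complex.I • (nabla (fun y ↦ cxIm (W y)) x).toLinearMap.baseChange ℂ

/-- The complex-bilinear extension of a metric. -/
def cxMetric (g : SmoothMetric E M) (x : M) : LinearMap.BilinForm ℂ (CTangent E x) :=
  LinearMap.BilinForm.baseChange ℂ (g.inner x).toLinearMap₁₂

variable {κ : SymplecticForm E M} (J : CalibratedStructure κ)

/-- `T^{(1,0)}_xM`, the `i`-eigenspace of `J` on `T_xM ⊗ ℂ`. -/
def T10 (x : M) : Submodule ℂ (CTangent E x) :=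
  End.eigenspace ((J.J x).toLinearMap.baseChange ℂ) Complex.I

/-- `T^{(0,1)}_xM`, the `-i`-eigenspace of `J` on `T_xM ⊗ ℂ`. -/
def T01 (x : M) : Submodule ℂ (CTangent E x) :=
  End.eigenspace ((J.J x).toLinearMap.baseChange ℂ) (-Complex.I)

/-- `W₁, …, Wₙ` is a smooth complex `(1,0)`-frame on `U`. -/
structure IsFrame10 {n : ℕ} (W : Fin n → Π x : M, CTangent E x) (U : Set M) : Prop where
  smooth (i : Fin n) : SmoothCFieldOn (W i) U
  linearIndependent (x : M) (hx : x ∈ U) : LinearIndependent ℂ (fun i ↦ W i x)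
  span_eq (x : M) (hx : x ∈ U) : Submodule.span ℂ (Set.range fun i ↦ W i x) = T10 J x

end Complexified

end

end AlmostKahler

open AlmostKahler

/-! Take W_i = e_i - iJe_i with real fields e_i, and adjust the 2-jets of the e_i at o.

The geometric input is the almost Kähler identity ∇_{Jv}J = -J∇_vJ. Closedness of κ makes the cyclic
sum of g((∇_X J)Y, Z) vanish; since ∇_X J anticommutes with J, the identity follows by pure algebra
(`eq_of_cyclic_sum_eq_zero`, `nablaJ_apply_J`). It says that the derivative of W_i along conj(W_k)
is of type (1,0) wherever the fields are smooth (`nabla_add_nabla_J`), so it equals s - iJs with s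
given by `mixedNabla`.

Order one: adding to e_i a field that vanishes at o makes ∇_u W_i(o) of type (0,1) for every u
(`exists_parallel_extension`). This is item 2. It gives dG(o) = 0, because g vanishes on pairs of
(0,1)-vectors; the values G(o) come from a unitary choice of e_i(o). It also gives s(o) = 0, a
vector being zero when it is of both types (`mixedNabla_eq_zero`), and item 1 is the conjugate of
this.

Order two: as s(o) = 0, item 4 reduces to the real equation ∇_{v_r}s = J∇_{Jv_r}s at o, where v_r =
e_r(o). Adding to e_i a field that vanishes to second order, with Hessian B, keeps the first-order
conditions and changes ∇_u s by B(u, v_k) + J B(u, Jv_k) (`nabla_mixedNabla_add`). The equation only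
sees the part of B that is complex linear in one argument and antilinear in the other; symmetry of B
does not restrict that part, so the equation can be solved (`exists_adapted_fields`). -/

namespace AlmostKahler

noncomputable section
-- Smoothness of the Levi-Civita derivative of smooth fields
section Connection

variable {E : Type*} [NormedAddCommGroup E] [NormedSpace ℝ E] [FiniteDimensional ℝ E]
  {M : Type*} [TopologicalSpace M] [ChartedSpace E M] [IsManifold 𝓘(ℝ, E) ∞ M]
  {g : SmoothMetric E M}
  {nabla : CovariantDerivative 𝓘(ℝ, E) E (fun x : M ↦ TangentSpace 𝓘(ℝ, E) x)}
  {X Y Z : Π x : M, TangentSpace 𝓘(ℝ, E) x} {f : M → ℝ} {x : M}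

lemma mdiffAt_of_smooth (hX : CMDiffAt ∞ (T% X) x) : MDiffAt (T% X) x :=
  hX.mdifferentiableAt (by simp)

lemma eventually_mdiffAt (hX : CMDiffAt ∞ (T% X) x) : ∀ᶠ y in nhds x, MDiffAt (T% X) y := by
  have h : CMDiffAt 1 (T% X) x := hX.of_le (by simp)
  filter_upwards [(contMDiffAt_iff_contMDiffAt_nhds (by simp)).1 h] with y hy
  exact ContMDiffAt.mdifferentiableAt hy (by simp)

variable (g) in
lemma contMDiffAt_metric (hX : CMDiffAt ∞ (T% X) x) (hY : CMDiffAt ∞ (T% Y) x) :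
    CMDiffAt ∞ (fun y ↦ g.inner y (X y) (Y y)) x := by
  have h := ContMDiffAt.clm_bundle_apply₂ (F₁ := E) (F₂ := E) (F₃ := ℝ)
    (E₃ := Bundle.Trivial M ℝ) (g.contMDiff x) hX hY
  simp only [contMDiffAt_totalSpace] at h
  exact h.2

/-- The derivative of a smooth function along a smooth vector field is smooth. -/
lemma contMDiffAt_mvfderiv_apply (hf : CMDiffAt ∞ f x) (hX : CMDiffAt ∞ (T% X) x) :
    CMDiffAt ∞ (fun y ↦ d% f y (X y)) x := by
  have h := hf.mfderiv_const (m := ∞) (by simp)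
  have h2 := ContMDiffAt.clm_apply_of_inCoordinates (𝕜 := ℝ) (F₁ := E) (F₂ := ℝ)
    (E₁ := TangentSpace 𝓘(ℝ, E) (M := M)) (E₂ := TangentSpace 𝓘(ℝ, ℝ) (M := ℝ))
    (b₁ := id) (b₂ := f) (ϕ := fun y ↦ mfderiv 𝓘(ℝ, E) 𝓘(ℝ, ℝ) f y)
    (v := X) h hX hf
  simp only [contMDiffAt_totalSpace] at h2
  have h3 := h2.2
  refine h3.congr_of_eventuallyEq (Filter.Eventually.of_forall fun y ↦ ?_)
  simp [mvfderiv, NormedSpace.fromTangentSpace]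
  rfl

lemma contMDiffAt_mlieBracket (hX : CMDiffAt ∞ (T% X) x) (hY : CMDiffAt ∞ (T% Y) x) :
    CMDiffAt ∞ (T% (VectorField.mlieBracket 𝓘(ℝ, E) X Y)) x :=
  have : IsManifold 𝓘(ℝ, E) (minSmoothness ℝ 2) M := .of_le (n := ∞) <| by
    rw [minSmoothness_of_isRCLikeNormedField]; exact ENat.LEInfty.out
  have : IsManifold 𝓘(ℝ, E) (((⊤ : ℕ∞) : ℕ∞ω) + 1) M := .of_le (n := ∞) (by simp)
  ContMDiffAt.mlieBracket_vectorField (m := ⊤) (n := ⊤) hX hY (by simp)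

variable (g) in
lemma contMDiffAt_koszul (hX : CMDiffAt ∞ (T% X) x) (hY : CMDiffAt ∞ (T% Y) x)
    (hZ : CMDiffAt ∞ (T% Z) x) : CMDiffAt ∞ (koszul g X Y Z) x := by
  refine .sub (.sub (.add (.sub (.add ?_ ?_) ?_) ?_) ?_) ?_
  · exact contMDiffAt_mvfderiv_apply (contMDiffAt_metric g hY hZ) hX
  · exact contMDiffAt_mvfderiv_apply (contMDiffAt_metric g hX hZ) hY
  · exact contMDiffAt_mvfderiv_apply (contMDiffAt_metric g hX hY) hZ
  · exact contMDiffAt_metric g (contMDiffAt_mlieBracket hX hY) hZ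
  · exact contMDiffAt_metric g (contMDiffAt_mlieBracket hX hZ) hY
  · exact contMDiffAt_metric g (contMDiffAt_mlieBracket hY hZ) hX

/-- The Koszul formula. -/
lemma IsLeviCivita.two_mul_inner (h : IsLeviCivita g nabla) (hX : MDiffAt (T% X) x)
    (hY : MDiffAt (T% Y) x) (hZ : MDiffAt (T% Z) x) :
    2 * g.inner x (nabla Y x (X x)) (Z x) = koszul g X Y Z x := by
  rw [koszul, h.metric _ hY hZ, h.metric _ hX hZ, h.metric _ hX hY, ← h.torsionFree hX hY,
    ← h.torsionFree hX hZ, ← h.torsionFree hY hZ]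
  simp only [map_sub, sub_apply]
  rw [g.symm x (Y x), g.symm x (X x) (nabla Z x (Y x)), g.symm x (X x) (nabla Y x (Z x))]
  ring

lemma contMDiffAt_det {ι : Type*} [Fintype ι] [DecidableEq ι] {A : M → Matrix ι ι ℝ}
    (hA : ∀ i j, CMDiffAt ∞ (fun y ↦ A y i j) x) : CMDiffAt ∞ (fun y ↦ (A y).det) x := by
  simp only [Matrix.det_apply']
  exact ContMDiffAt.sum fun σ _ ↦ contMDiffAt_const.mul (ContMDiffAt.prod fun i _ ↦ hA _ _)

/-- The covariant derivative of a smooth vector field along another one is smooth. -/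
lemma IsLeviCivita.contMDiffAt (h : IsLeviCivita g nabla) (hX : CMDiffAt ∞ (T% X) x)
    (hY : CMDiffAt ∞ (T% Y) x) : CMDiffAt ∞ (T% (fun y ↦ nabla Y y (X y))) x := by
  classical
  let e := trivializationAt E (TangentSpace 𝓘(ℝ, E) (M := M)) x
  let b := Module.finBasis ℝ E
  let s := e.localFrame b
  have hxe : x ∈ e.baseSet := FiberBundle.mem_baseSet_trivializationAt' x
  have hmem : e.baseSet ∈ nhds x := e.open_baseSet.mem_nhds hxe
  have hs : IsLocalFrameOn 𝓘(ℝ, E) E ∞ s e.baseSet :=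
    e.isLocalFrameOn_localFrame_baseSet 𝓘(ℝ, E) ∞ b
  have hsx (i) : CMDiffAt ∞ (T% (s i)) x := hs.contMDiffAt e.open_baseSet hxe i
  -- In a local frame the coefficients of ∇_X Y solve a linear system: its matrix is the Gram matrix
  -- of the frame, its right-hand side half the Koszul expression. Cramer's rule expresses the
  -- solution smoothly.
  let A : M → Matrix (Fin (finrank ℝ E)) (Fin (finrank ℝ E)) ℝ :=
    fun y ↦ Matrix.of fun i j ↦ g.inner y (s j y) (s i y)
  let k : M → Fin (finrank ℝ E) → ℝ := fun y i ↦ (1 / 2) * koszul g X Y (s i) y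
  have hA (i j) : CMDiffAt ∞ (fun y ↦ A y i j) x := contMDiffAt_metric g (hsx j) (hsx i)
  have hk (i) : CMDiffAt ∞ (fun y ↦ k y i) x :=
    contMDiffAt_const.mul (contMDiffAt_koszul g hX hY (hsx i))
  have hdet : ∀ y ∈ e.baseSet, (A y).det ≠ 0 := by
    intro y hy h0
    obtain ⟨v, hv, hv0⟩ := Matrix.exists_mulVec_eq_zero_iff.2 h0
    have hz : ∑ j, v j • s j y = 0 := by
      -- A kernel vector of the Gram matrix gives a combination of the frame of zero length,
      -- contradicting positivity of g.
      by_contra hne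
      have hpos := g.pos y _ hne
      have hzero : g.inner y (∑ j, v j • s j y) (∑ j, v j • s j y) = 0 := by
        rw [map_sum (g.inner y (∑ j, v j • s j y))]
        refine Finset.sum_eq_zero fun i _ ↦ ?_
        have := congrFun hv0 i
        simp only [Matrix.mulVec, dotProduct, A, Matrix.of_apply, Pi.zero_apply] at this
        rw [map_smul, map_sum, sum_apply]
        simp only [map_smul, smul_apply, smul_eq_mul]
        rw [← mul_zero (v i), ← this]
        congr 1
        exact Finset.sum_congr rfl fun _ _ ↦ mul_comm _ _
      exact hpos.ne' hzero
    exact hv (funext (Fintype.linearIndependent_iff.1 (hs.linearIndependent hy) v hz))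
  have hsm : CMDiffAt ∞ (T% (fun y ↦ ∑ j, ((A y).det⁻¹ * (A y).cramer (k y) j) • s j y)) x := by
    refine ContMDiffAt.sum_section fun j _ ↦ ContMDiffAt.smul_section ?_ (hsx j)
    refine ((contMDiffAt_det hA).inv₀ (hdet x hxe)).mul ?_
    simp only [Matrix.cramer_apply]
    refine contMDiffAt_det fun i l ↦ ?_
    by_cases hl : l = j
    · subst hl; simpa using hk i
    · simpa [Matrix.updateCol_apply, hl] using hA i l
  refine hsm.congr_of_eventuallyEq ?_
  have hse : ∀ᶠ y in nhds x, ∀ i, MDiffAt (T% (s i)) y :=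
    Filter.eventually_all.2 fun i ↦ eventually_mdiffAt (hsx i)
  filter_upwards [hmem, eventually_mdiffAt hX, eventually_mdiffAt hY, hse] with y hy hXy hYy hsy
  have hsum := hs.coeff_sum_eq (fun y ↦ nabla Y y (X y)) hy
  set c : Fin (finrank ℝ E) → ℝ := fun j ↦ hs.coeff j y (nabla Y y (X y)) with hc
  have hsum' : nabla Y y (X y) = ∑ j, c j • s j y := by rw [hsum]
  have hmul : (A y).mulVec c = k y := by
    ext i
    simp only [k, ← h.two_mul_inner hXy hYy (hsy i), hsum']
    simp only [Matrix.mulVec, dotProduct, A, Matrix.of_apply]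
    rw [map_sum, sum_apply]
    simp only [map_smul, smul_apply, smul_eq_mul]
    rw [← mul_assoc]
    norm_num
    exact Finset.sum_congr rfl fun _ _ ↦ mul_comm _ _
  have hcr : (A y).cramer (k y) = (A y).det • c := by
    rw [← hmul, Matrix.cramer_eq_adjugate_mulVec, Matrix.mulVec_mulVec, Matrix.adjugate_mul,
      Matrix.smul_mulVec, Matrix.one_mulVec]
  congr 1
  rw [hsum', hcr]
  refine Finset.sum_congr rfl fun j _ ↦ ?_
  rw [Pi.smul_apply, smul_eq_mul, inv_mul_cancel_left₀ (hdet y hy)]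

end Connection
-- Fields and functions with prescribed jets at a point
section Jets

variable {E : Type*} [NormedAddCommGroup E] [NormedSpace ℝ E] [FiniteDimensional ℝ E]
  {M : Type*} [TopologicalSpace M] [ChartedSpace E M] [IsManifold 𝓘(ℝ, E) ∞ M]
  {g : SmoothMetric E M}
  {nabla : CovariantDerivative 𝓘(ℝ, E) E (fun x : M ↦ TangentSpace 𝓘(ℝ, E) x)}
  {V X Y Z : Π x : M, TangentSpace 𝓘(ℝ, E) x} {f f₁ f₂ : M → ℝ} {o : M}

lemma contMDiffAt_of_chart (hX : CMDiff[(chartAt E o).source] ∞ (T% X)) :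
    CMDiffAt ∞ (T% X) o :=
  hX.contMDiffAt ((chartAt E o).open_source.mem_nhds (mem_chart_source E o))

lemma contMDiffAt_fun_of_chart (hf : CMDiff[(chartAt E o).source] ∞ f) : CMDiffAt ∞ f o :=
  hf.contMDiffAt ((chartAt E o).open_source.mem_nhds (mem_chart_source E o))

lemma exists_smooth_extension (v : TangentSpace 𝓘(ℝ, E) o) :
    ∃ X : Π x : M, TangentSpace 𝓘(ℝ, E) x, CMDiff[(chartAt E o).source] ∞ (T% X) ∧ X o = v := by
  refine ⟨FiberBundle.extend E v, ?_, FiberBundle.extend_apply_self ..⟩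
  set t := trivializationAt E (TangentSpace 𝓘(ℝ, E) (M := M)) o
  have ht : t.baseSet = (chartAt E o).source := TangentBundle.trivializationAt_baseSet o
  rw [← ht, t.contMDiffOn_section_baseSet_iff]
  refine (contMDiffOn_const (c := (t ⟨o, v⟩).2)).congr fun x hx ↦ ?_
  exact (congrArg Prod.snd (t.apply_mk_symm hx (t ⟨o, v⟩).2) :)

/-- There is a smooth function that vanishes at `o` with a given differential there. -/
lemma exists_smooth_function (l : TangentSpace 𝓘(ℝ, E) o →L[ℝ] ℝ) :
    ∃ f : M → ℝ, CMDiff[(chartAt E o).source] ∞ f ∧ f o = 0 ∧ d% f o = l := by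
  obtain ⟨A, hA⟩ := isInvertible_mfderiv_extChartAt (I := 𝓘(ℝ, E))
    (mem_extChartAt_source (I := 𝓘(ℝ, E)) o)
  -- The function is linear in the chart; undoing the differential of the chart at o makes its
  -- differential equal to `l`.
  let m : E →L[ℝ] ℝ := l.comp A.symm.toContinuousLinearMap
  let φ := extChartAt 𝓘(ℝ, E) o
  have hφ : CMDiff[(chartAt E o).source] ∞ φ := contMDiffOn_extChartAt
  refine ⟨fun x ↦ m (φ x) - m (φ o), ?_, sub_self _, ?_⟩
  · exact (m.contMDiff.comp_contMDiffOn hφ).sub contMDiffOn_const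
  · have hφo : HasMFDerivAt 𝓘(ℝ, E) 𝓘(ℝ, E) φ o A.toContinuousLinearMap := by
      rw [hA]
      exact (mdifferentiableAt_extChartAt (mem_chart_source E o)).hasMFDerivAt
    have h1 : HasMFDerivAt 𝓘(ℝ, E) 𝓘(ℝ, ℝ) (m ∘ φ) o (m.comp A.toContinuousLinearMap) :=
      HasMFDerivAt.comp o m.hasMFDerivAt hφo
    have h2 := h1.sub (hasMFDerivAt_const (I := 𝓘(ℝ, E)) (I' := 𝓘(ℝ, ℝ)) (m (φ o)) o)
    ext v
    have h3 := h2.mfderiv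
    have h4 : mfderiv 𝓘(ℝ, E) 𝓘(ℝ, ℝ) (fun x ↦ m (φ x) - m (φ o)) o v = l v := by
      change mfderiv 𝓘(ℝ, E) 𝓘(ℝ, ℝ) ((m ∘ φ) - fun _ ↦ m (φ o)) o v = l v
      rw [h3]
      change l (A.symm (A v)) - 0 = l v
      rw [sub_zero]
      exact congrArg l (A.symm_apply_apply v)
    exact h4

lemma mdiffAt_add (hX : MDiffAt (T% X) o) (hY : MDiffAt (T% Y) o) :
    MDiffAt (T% (fun x ↦ X x + Y x)) o :=
  mdifferentiableAt_add_section hX hY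

lemma mdiffAt_smul (hf : MDiffAt f o) (hX : MDiffAt (T% X) o) :
    MDiffAt (T% (fun x ↦ f x • X x)) o :=
  hf.smul_section hX

variable (nabla)

lemma nabla_add (hX : MDiffAt (T% X) o) (hY : MDiffAt (T% Y) o) (v : TangentSpace 𝓘(ℝ, E) o) :
    nabla (fun x ↦ X x + Y x) o v = nabla X o v + nabla Y o v := by
  have := nabla.isCovariantDerivativeOnUniv.add hX hY
  exact congrArg (fun A : _ →L[ℝ] _ ↦ A v) this

lemma nabla_smul (hf : MDiffAt f o) (hX : MDiffAt (T% X) o) (v : TangentSpace 𝓘(ℝ, E) o) :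
    nabla (fun x ↦ f x • X x) o v = f o • nabla X o v + d% f o v • X o := by
  have := nabla.isCovariantDerivativeOnUniv.leibniz hX hf
  exact congrArg (fun A : _ →L[ℝ] _ ↦ A v) this

lemma nabla_neg (hX : MDiffAt (T% X) o) (v : TangentSpace 𝓘(ℝ, E) o) :
    nabla (fun x ↦ -X x) o v = -nabla X o v := by
  have := nabla.isCovariantDerivativeOnUniv.smul_const (-1) hX
  have h := congrArg (fun A : _ →L[ℝ] _ ↦ A v) this
  simp only [neg_smul, one_smul, neg_apply] at h
  rw [← h]
  congr 2

lemma nabla_zero (v : TangentSpace 𝓘(ℝ, E) o) : nabla (fun _ ↦ 0) o v = 0 := by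
  change nabla 0 o v = 0
  rw [nabla.zero]; rfl

lemma nabla_congr (hY : MDiffAt (T% Y) o) (h : ∀ᶠ x in nhds o, X x = Y x) :
    nabla X o = nabla Y o := by
  refine nabla.isCovariantDerivativeOnUniv.congr_of_eventuallyEq ?_ hY Filter.univ_mem h
  exact hY.congr_of_eventuallyEq (h.mono fun x hx ↦ by simp [hx])

lemma nabla_smul_of_eq_zero (hf : MDiffAt f o) (hf0 : f o = 0) (hX : MDiffAt (T% X) o)
    (v : TangentSpace 𝓘(ℝ, E) o) : nabla (fun x ↦ f x • X x) o v = d% f o v • X o := by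
  rw [nabla_smul nabla hf hX, hf0, zero_smul, zero_add]

variable {nabla}

lemma mvfderiv_mul_of_eq_zero (hf : MDiffAt f₁ o) (hf0 : f₁ o = 0) (hf' : MDiffAt f₂ o)
    (v : TangentSpace 𝓘(ℝ, E) o) : d% (fun x ↦ f₁ x * f₂ x) o v = f₂ o * d% f₁ o v := by
  rw [mvfderiv_fun_mul hf hf', hf0]
  simp

/-- The second covariant derivative at `o` of a field `f₁ f₂ X`, where `f₁` and `f₂` vanish
at `o`. -/
lemma IsLeviCivita.nabla_nabla_mul_smul (h : IsLeviCivita g nabla)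
    (hf₁ : CMDiffAt ∞ f₁ o) (hf₂ : CMDiffAt ∞ f₂ o) (h₁ : f₁ o = 0) (h₂ : f₂ o = 0)
    (hX : CMDiffAt ∞ (T% X) o) (hV : CMDiffAt ∞ (T% V) o) (u : TangentSpace 𝓘(ℝ, E) o) :
    nabla (fun x ↦ nabla (fun y ↦ (f₁ y * f₂ y) • X y) x (V x)) o u =
      (d% f₁ o u * d% f₂ o (V o) + d% f₂ o u * d% f₁ o (V o)) • X o := by
  have m₁ : MDiffAt f₁ o := hf₁.mdifferentiableAt (by simp)
  have m₂ : MDiffAt f₂ o := hf₂.mdifferentiableAt (by simp)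
  have c₁ := contMDiffAt_mvfderiv_apply hf₁ hV
  have c₂ := contMDiffAt_mvfderiv_apply hf₂ hV
  have d₁ : MDiffAt (fun y ↦ d% f₁ y (V y)) o := c₁.mdifferentiableAt (by simp)
  have d₂ : MDiffAt (fun y ↦ d% f₂ y (V y)) o := c₂.mdifferentiableAt (by simp)
  have n := h.contMDiffAt hV hX
  have mX := mdiffAt_of_smooth hX
  have mn := mdiffAt_of_smooth n
  have e₁ : ∀ᶠ y in nhds o, MDiffAt f₁ y := by
    filter_upwards [(contMDiffAt_iff_contMDiffAt_nhds (n := 1) (by simp)).1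
      (hf₁.of_le (by simp))] with y hy using ContMDiffAt.mdifferentiableAt hy (by simp)
  have e₂ : ∀ᶠ y in nhds o, MDiffAt f₂ y := by
    filter_upwards [(contMDiffAt_iff_contMDiffAt_nhds (n := 1) (by simp)).1
      (hf₂.of_le (by simp))] with y hy using ContMDiffAt.mdifferentiableAt hy (by simp)
  -- After one derivative both coefficients still vanish at o, so the second derivative only
  -- differentiates the coefficients. The coefficient f₁f₂ vanishes to second order and contributes
  -- nothing.
  have hev : ∀ᶠ x in nhds o, nabla (fun y ↦ (f₁ y * f₂ y) • X y) x (V x) =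
      (f₁ x * f₂ x) • nabla X x (V x) +
        (f₁ x * d% f₂ x (V x) + f₂ x * d% f₁ x (V x)) • X x := by
    filter_upwards [e₁, e₂, eventually_mdiffAt hX] with x h1 h2 hx
    rw [nabla_smul nabla (f := fun y ↦ f₁ y * f₂ y) (h1.mul h2) hx, mvfderiv_fun_mul h1 h2]
    simp
  have s₁ : MDiffAt (fun y ↦ f₁ y * f₂ y) o := m₁.mul m₂
  have s₂ : MDiffAt (fun y ↦ f₁ y * d% f₂ y (V y) + f₂ y * d% f₁ y (V y)) o :=
    (m₁.mul d₂).add (m₂.mul d₁)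
  rw [nabla_congr nabla (mdiffAt_add (mdiffAt_smul s₁ mn) (mdiffAt_smul s₂ mX)) hev,
    nabla_add nabla (mdiffAt_smul s₁ mn) (mdiffAt_smul s₂ mX),
    nabla_smul_of_eq_zero nabla s₁ (by simp [h₁]) mn,
    nabla_smul_of_eq_zero nabla s₂ (by simp [h₁, h₂]) mX]
  have q₁ : d% (fun y ↦ f₁ y * f₂ y) o u = 0 := by
    rw [mvfderiv_mul_of_eq_zero m₁ h₁ m₂, h₂, zero_mul]
  have q₂ : d% (fun y ↦ f₁ y * d% f₂ y (V y) + f₂ y * d% f₁ y (V y)) o u =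
      d% f₂ o (V o) * d% f₁ o u + d% f₁ o (V o) * d% f₂ o u := by
    rw [mvfderiv_fun_add (g := fun y ↦ f₁ y * d% f₂ y (V y))
      (g' := fun y ↦ f₂ y * d% f₁ y (V y)) (m₁.mul d₂) (m₂.mul d₁), add_apply,
      mvfderiv_mul_of_eq_zero m₁ h₁ d₂, mvfderiv_mul_of_eq_zero m₂ h₂ d₁]
  rw [q₁, q₂, zero_smul, zero_add]
  congr 1
  ring

end Jets

/-! ### The covariant derivative of J on an almost Kähler manifold -/

/-- A family `a` of trilinear type on which `j` acts like an almost complex structure and which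
satisfies the identities of `g((∇_X J) Y, Z)` on an almost Kähler manifold is of type
`a (j X) Y Z = a X Y (j Z)`. -/
lemma eq_of_cyclic_sum_eq_zero {F : Type*} {j : F → F} {a : F → F → F → ℝ}
    (shift : ∀ X Y Z, a X (j Y) Z = a X Y (j Z))
    (cyc : ∀ X Y Z, a X Y Z + a Y Z X + a Z X Y = 0)
    (sq_left : ∀ X Y Z, a (j (j X)) Y Z = -a X Y Z)
    (sq_mid : ∀ X Y Z, a X (j (j Y)) Z = -a X Y Z) (X Y Z : F) :
    a (j X) Y Z = a X Y (j Z) := by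
  -- Put D(X, Y, Z) = a (j X) Y Z - a X (j Y) Z. Here D is shown to be invariant under cyclic
  -- permutation, and `flip` says D(jX, Y, Z) = -D(X, jY, Z).
  have rot (X Y Z) : a (j X) Y Z - a X (j Y) Z = a (j Y) Z X - a Y (j Z) X := by
    have h1 := cyc (j X) Y Z
    have h2 := cyc X (j Y) Z
    rw [← shift Y Z X] at h1
    rw [← shift Z X Y] at h2
    linarith
  have flip (X Y Z) : a (j (j X)) Y Z - a (j X) (j Y) Z =
      -(a (j X) (j Y) Z - a X (j (j Y)) Z) := by
    rw [sq_left, sq_mid]; ring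
  -- Carrying j once around the three slots of D costs three signs, so D(X, jY, Z) equals its own
  -- negative.
  have key (X Y Z) : a (j X) (j Y) Z - a X (j (j Y)) Z = 0 := by
    have h1 := rot X (j Y) Z
    have h2 := flip Y Z X
    have h3 := rot Y (j Z) X
    have h4 := flip Z X Y
    have h5 := rot Z (j X) Y
    have h6 := flip X Y Z
    linarith
  have h := key X (j Y) Z
  rw [sq_mid, sq_mid, shift] at h
  linarith

section Calibrated

variable {E : Type*} [NormedAddCommGroup E] [NormedSpace ℝ E] [FiniteDimensional ℝ E]
  {M : Type*} [TopologicalSpace M] [ChartedSpace E M] [IsManifold 𝓘(ℝ, E) ∞ M]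
  {κ : SymplecticForm E M} (J : CalibratedStructure κ)
  {nabla : CovariantDerivative 𝓘(ℝ, E) E (fun x : M ↦ TangentSpace 𝓘(ℝ, E) x)}
  {V X Y Z : Π x : M, TangentSpace 𝓘(ℝ, E) x} {f : M → ℝ} {x : M}

lemma contMDiffOn_J {s : Set M} (hX : CMDiff[s] ∞ (T% X)) :
    CMDiff[s] ∞ (T% (fun y ↦ J.J y (X y))) :=
  ContMDiffOn.clm_bundle_apply (F₁ := E) (F₂ := E) J.smooth.contMDiffOn hX

lemma contMDiffAt_J (hX : CMDiffAt ∞ (T% X) x) : CMDiffAt ∞ (T% (fun y ↦ J.J y (X y))) x :=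
  ContMDiffAt.clm_bundle_apply (F₁ := E) (F₂ := E) (J.smooth x) hX

lemma mdiffAt_J (hX : MDiffAt (T% X) x) : MDiffAt (T% (fun y ↦ J.J y (X y))) x :=
  MDifferentiableAt.clm_bundle_apply (F₁ := E) (F₂ := E)
    ((J.smooth x).mdifferentiableAt (by simp)) hX

lemma form_eq_neg_metric (v w : TangentSpace 𝓘(ℝ, E) x) :
    κ.form x v w = -J.metric.inner x (J.J x v) w := by
  change _ = -κ.form x (J.J x (J.J x v)) w
  rw [J.sq, map_neg]
  simp

lemma metric_J_left (v w : TangentSpace 𝓘(ℝ, E) x) :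
    J.metric.inner x (J.J x v) w = -J.metric.inner x v (J.J x w) := by
  have h := form_eq_neg_metric J v w
  have h' : J.metric.inner x v (J.J x w) = κ.form x v w := J.invariant x v w
  rw [h']; linarith

lemma metric_J_J (v w : TangentSpace 𝓘(ℝ, E) x) :
    J.metric.inner x (J.J x v) (J.J x w) = J.metric.inner x v w := by
  rw [metric_J_left, J.sq, map_neg, neg_neg]

variable (nabla) in
/-- The covariant derivative `(∇_v J) Y` of the almost complex structure. -/
def nablaJ (Y : Π x : M, TangentSpace 𝓘(ℝ, E) x) (x : M) (v : TangentSpace 𝓘(ℝ, E) x) :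
    TangentSpace 𝓘(ℝ, E) x :=
  nabla (fun y ↦ J.J y (Y y)) x v - J.J x (nabla Y x v)

variable {J}

lemma nablaJ_neg (hY : MDiffAt (T% Y) x) (v : TangentSpace 𝓘(ℝ, E) x) :
    nablaJ J nabla (fun y ↦ -Y y) x v = -nablaJ J nabla Y x v := by
  simp only [nablaJ, map_neg, nabla_neg nabla hY, nabla_neg nabla (mdiffAt_J J hY)]
  abel

lemma nablaJ_J (hY : MDiffAt (T% Y) x) (v : TangentSpace 𝓘(ℝ, E) x) :
    nablaJ J nabla (fun y ↦ J.J y (Y y)) x v = -J.J x (nablaJ J nabla Y x v) := by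
  simp only [nablaJ, J.sq, nabla_neg nabla hY, map_sub]
  abel

/-- J is skew for g; differentiate g(JY, Z) = -g(Y, JZ) using metric compatibility. -/
lemma inner_nablaJ_anti (h : IsLeviCivita J.metric nabla) (v : TangentSpace 𝓘(ℝ, E) x)
    (hY : MDiffAt (T% Y) x) (hZ : MDiffAt (T% Z) x) :
    J.metric.inner x (nablaJ J nabla Y x v) (Z x) =
      -J.metric.inner x (nablaJ J nabla Z x v) (Y x) := by
  have h1 := h.metric v (mdiffAt_J J hY) hZ
  have h2 := h.metric v hY (mdiffAt_J J hZ)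
  have h3 : (fun y ↦ J.metric.inner y (J.J y (Y y)) (Z y)) =
      fun y ↦ -J.metric.inner y (Y y) (J.J y (Z y)) := by
    ext y; exact metric_J_left J _ _
  have h4 := mvfderiv_fun_neg (I := 𝓘(ℝ, E)) (g := fun y ↦ J.metric.inner y (Y y) (J.J y (Z y)))
    (x := x)
  rw [h3, h4, neg_apply, h2] at h1
  simp only [nablaJ, map_sub, sub_apply]
  have h5 := metric_J_left J (nabla Y x v) (Z x)
  have h6 := metric_J_left J (nabla Z x v) (Y x)
  rw [J.metric.symm x (nabla Z x v)] at h6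
  have h7 := J.metric.symm x (nabla (fun y ↦ J.J y (Z y)) x v) (Y x)
  linarith

/-- This is dκ = 0. With κ = -g(J·, ·) and brackets written as differences of covariant derivatives,
the terms containing ∇X, ∇Y, ∇Z cancel and only ∇J survives. -/
lemma inner_nablaJ_cyclic (h : IsLeviCivita J.metric nabla) (hX : CMDiffAt ∞ (T% X) x)
    (hY : CMDiffAt ∞ (T% Y) x) (hZ : CMDiffAt ∞ (T% Z) x) :
    J.metric.inner x (nablaJ J nabla Y x (X x)) (Z x) +
      J.metric.inner x (nablaJ J nabla Z x (Y x)) (X x) +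
      J.metric.inner x (nablaJ J nabla X x (Z x)) (Y x) = 0 := by
  have hc := κ.closed X Y Z x hX hY hZ
  have mX := mdiffAt_of_smooth hX
  have mY := mdiffAt_of_smooth hY
  have mZ := mdiffAt_of_smooth hZ
  have hd {A B : Π x : M, TangentSpace 𝓘(ℝ, E) x} (v : TangentSpace 𝓘(ℝ, E) x)
      (hA : MDiffAt (T% A) x) (hB : MDiffAt (T% B) x) :
      d% (fun y ↦ κ.form y (A y) (B y)) x v =
        -(J.metric.inner x (nablaJ J nabla A x v) (B x)
          + J.metric.inner x (J.J x (nabla A x v)) (B x)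
          - J.metric.inner x (J.J x (nabla B x v)) (A x)) := by
    have e : (fun y ↦ κ.form y (A y) (B y)) =
        fun y ↦ -J.metric.inner y (J.J y (A y)) (B y) := by
      ext y; exact form_eq_neg_metric J _ _
    have h4 := mvfderiv_fun_neg (I := 𝓘(ℝ, E))
      (g := fun y ↦ J.metric.inner y (J.J y (A y)) (B y)) (x := x)
    rw [e, h4, neg_apply, h.metric v (mdiffAt_J J hA) hB]
    simp only [nablaJ, map_sub, sub_apply]
    rw [metric_J_left J (A x), J.metric.symm x (A x)]
    ring
  rw [extDerivTwoForm, hd _ mY mZ, hd _ mX mZ, hd _ mX mY, ← h.torsionFree mX mY,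
    ← h.torsionFree mX mZ, ← h.torsionFree mY mZ] at hc
  simp only [form_eq_neg_metric J, map_sub, sub_apply] at hc
  have h1 := inner_nablaJ_anti h (Y x) mX mZ
  linarith

/-- On an almost Kähler manifold, `∇_{Jv} J = -J ∇_v J`. -/
lemma nablaJ_apply_J (h : IsLeviCivita J.metric nabla) (hY : CMDiffAt ∞ (T% Y) x)
    (v : TangentSpace 𝓘(ℝ, E) x) :
    nablaJ J nabla Y x (J.J x v) = -J.J x (nablaJ J nabla Y x v) := by
  -- The algebraic lemma is applied to fields rather than vectors, so no tensoriality of `nablaJ` in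
  -- its field argument is needed here.
  let F := {X : Π x : M, TangentSpace 𝓘(ℝ, E) x // CMDiffAt ∞ (T% X) x}
  let j : F → F := fun X ↦ ⟨fun y ↦ J.J y (X.1 y), contMDiffAt_J J X.2⟩
  let a : F → F → F → ℝ := fun X Y Z ↦ J.metric.inner x (nablaJ J nabla Y.1 x (X.1 x)) (Z.1 x)
  have key := eq_of_cyclic_sum_eq_zero (j := j) (a := a)
    (fun X Y Z ↦ by
      simp only [a, j, nablaJ_J (mdiffAt_of_smooth Y.2)]
      rw [map_neg, neg_apply, metric_J_left, neg_neg])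
    (fun X Y Z ↦ inner_nablaJ_cyclic h X.2 Y.2 Z.2)
    (fun X Y Z ↦ by simp [a, j, nablaJ, J.sq]; ring)
    (fun X Y Z ↦ by
      simp only [a, j, J.sq, nablaJ_neg (mdiffAt_of_smooth Y.2)]
      rw [map_neg, neg_apply])
  obtain ⟨X, hX, rfl⟩ := exists_smooth_extension v
  refine metric_ext J.metric fun u ↦ ?_
  obtain ⟨Z, hZ, rfl⟩ := exists_smooth_extension u
  have := key ⟨X, contMDiffAt_of_chart hX⟩ ⟨Y, hY⟩ ⟨Z, contMDiffAt_of_chart hZ⟩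
  simp only [a, j] at this
  rw [this, map_neg, neg_apply, metric_J_left, neg_neg]

/-- `∇_{v + iJv} (Y - iJY)` is of type `(1,0)`. -/
lemma nabla_add_nabla_J (h : IsLeviCivita J.metric nabla) (hY : CMDiffAt ∞ (T% Y) x)
    (v : TangentSpace 𝓘(ℝ, E) x) :
    nabla (fun y ↦ J.J y (Y y)) x v - nabla Y x (J.J x v) =
      J.J x (nabla Y x v + nabla (fun y ↦ J.J y (Y y)) x (J.J x v)) := by
  have := congrArg (J.J x) (nablaJ_apply_J h hY v)
  simp only [nablaJ, map_sub, map_neg, J.sq, map_add] at this ⊢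
  rw [sub_neg_eq_add] at this
  rw [sub_eq_iff_eq_add, add_assoc, this]
  abel

lemma tensorialAt_nablaJ (v : TangentSpace 𝓘(ℝ, E) x) :
    TensorialAt 𝓘(ℝ, E) E (fun Y ↦ nablaJ J nabla Y x v) x where
  smul {f Y} hf hY := by
    have h1 := nabla_smul nabla hf hY v
    have h2 := nabla_smul nabla hf (mdiffAt_J J hY) v
    simp only [nablaJ, Pi.smul_apply', map_smul]
    change nabla (fun y ↦ f y • J.J y (Y y)) x v - J.J x (nabla (fun y ↦ f y • Y y) x v) = _
    rw [h1, h2, map_add, map_smul, map_smul, smul_sub]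
    abel
  add {Y Y'} hY hY' := by
    have h1 := nabla_add nabla hY hY' v
    have h2 := nabla_add nabla (mdiffAt_J J hY) (mdiffAt_J J hY') v
    simp only [nablaJ, Pi.add_apply, map_add]
    change nabla (fun y ↦ J.J y (Y y) + J.J y (Y' y)) x v
      - J.J x (nabla (fun y ↦ Y y + Y' y) x v) = _
    rw [h1, h2, map_add]
    abel

/-- `nablaJ` is tensorial in Y, hence zero where Y vanishes. This lets J pass through ∇ both for
correction terms and in item 4. -/
lemma nabla_J_of_eq_zero (hY : MDiffAt (T% Y) x) (h0 : Y x = 0) (v : TangentSpace 𝓘(ℝ, E) x) :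
    nabla (fun y ↦ J.J y (Y y)) x v = J.J x (nabla Y x v) := by
  have ht := tensorialAt_nablaJ (J := J) (nabla := nabla) v
  have h1 := ht.pointwise hY (σ' := 0) (mdifferentiableAt_zeroSection ..) (by simpa using h0)
  simp only [ht.zero] at h1
  exact sub_eq_zero.1 h1

end Calibrated
-- Unitary vectors at o and the correction of their extensions to second order
section AdaptedFields

variable {E : Type*} [NormedAddCommGroup E] [NormedSpace ℝ E] [FiniteDimensional ℝ E]
  {M : Type*} [TopologicalSpace M] [ChartedSpace E M] [IsManifold 𝓘(ℝ, E) ∞ M]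
  {κ : SymplecticForm E M} {J : CalibratedStructure κ}
  {nabla : CovariantDerivative 𝓘(ℝ, E) E (fun x : M ↦ TangentSpace 𝓘(ℝ, E) x)}
  {V X X' Y Y' Z : Π x : M, TangentSpace 𝓘(ℝ, E) x} {f₁ f₂ : M → ℝ} {o : M}

instance (x : M) : FiniteDimensional ℝ (TangentSpace 𝓘(ℝ, E) x) :=
  inferInstanceAs (FiniteDimensional ℝ E)

instance (x : M) : T2Space (TangentSpace 𝓘(ℝ, E) x) := inferInstanceAs (T2Space E)

lemma contMDiffOn_zero_field {s : Set M} :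
    CMDiff[s] ∞ (T% (fun x : M ↦ (0 : TangentSpace 𝓘(ℝ, E) x))) :=
  (contMDiff_zeroSection ℝ (TangentSpace 𝓘(ℝ, E) (M := M)) : ContMDiff _ _ _ _).contMDiffOn

lemma metric_self_J (v : TangentSpace 𝓘(ℝ, E) o) : J.metric.inner o v (J.J o v) = 0 := by
  have h := metric_J_left J v v
  rw [J.metric.symm] at h
  linarith

variable (J) in
/-- `v` is an orthogonal family for the hermitian metric of `J` at `o`, with all vectors of squared
length `1 / 2`. -/
structure IsUnitaryFamily {m : ℕ} (v : Fin m → TangentSpace 𝓘(ℝ, E) o) : Prop where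
  inner (r s : Fin m) : J.metric.inner o (v r) (v s) = if r = s then 1 / 2 else 0
  inner_J (r s : Fin m) : J.metric.inner o (v r) (J.J o (v s)) = 0

variable (J o) in
-- Hermitian Gram–Schmidt: being orthogonal to every v_r and Jv_r is 2m < 2n linear conditions, so a
-- further vector u exists; u ⊥ Ju is automatic.
lemma exists_isUnitaryFamily {n : ℕ} (hE : finrank ℝ E = 2 * n) (m : ℕ) (hm : m ≤ n) :
    ∃ v : Fin m → TangentSpace 𝓘(ℝ, E) o, IsUnitaryFamily J v := by
  induction m with
  | zero => exact ⟨Fin.elim0, fun r ↦ r.elim0, fun r ↦ r.elim0⟩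
  | succ m ih =>
    obtain ⟨v, hv⟩ := ih (by omega)
    let L : TangentSpace 𝓘(ℝ, E) o →ₗ[ℝ] (Fin m → ℝ) × (Fin m → ℝ) :=
      LinearMap.prod (LinearMap.pi fun r ↦ (J.metric.inner o (v r)).toLinearMap)
        (LinearMap.pi fun r ↦ (J.metric.inner o (J.J o (v r))).toLinearMap)
    have hfr : finrank ℝ (TangentSpace 𝓘(ℝ, E) o) = 2 * n := hE
    have hker : LinearMap.ker L ≠ ⊥ := by
      refine LinearMap.ker_ne_bot_of_finrank_lt ?_
      rw [hfr, finrank_prod, finrank_fin_fun]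
      omega
    obtain ⟨u, hu, hu0⟩ := (Submodule.ne_bot_iff _).1 hker
    have hu1 (r) : J.metric.inner o (v r) u = 0 :=
      congrFun (congrArg Prod.fst (LinearMap.mem_ker.1 hu)) r
    have hu2 (r) : J.metric.inner o (J.J o (v r)) u = 0 :=
      congrFun (congrArg Prod.snd (LinearMap.mem_ker.1 hu)) r
    have hpos := J.metric.pos o u hu0
    set q := J.metric.inner o u u with hq
    -- Scales u to squared length 1/2, which makes u - iJu a unit vector (see the factor 2 in
    -- `cxMetric_holo`).
    let c : ℝ := (Real.sqrt (2 * q))⁻¹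
    have hc : c * (c * q) = 1 / 2 := by
      have : Real.sqrt (2 * q) * Real.sqrt (2 * q) = 2 * q := Real.mul_self_sqrt (by linarith)
      rw [← mul_assoc, ← mul_inv, this]
      field_simp
    refine ⟨Fin.snoc v (c • u), ⟨fun r s ↦ ?_, fun r s ↦ ?_⟩⟩
    · induction r using Fin.lastCases with
      | last =>
        induction s using Fin.lastCases with
        | last => simpa using hc
        | cast s =>
          rw [Fin.snoc_last, Fin.snoc_castSucc, J.metric.symm, map_smul, hu1]
          simp [(Fin.castSucc_lt_last s).ne']
      | cast r =>
        induction s using Fin.lastCases with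
        | last =>
          rw [Fin.snoc_last, Fin.snoc_castSucc, map_smul, hu1]
          simp [(Fin.castSucc_lt_last r).ne]
        | cast s => simpa using hv.inner r s
    · induction r using Fin.lastCases with
      | last =>
        induction s using Fin.lastCases with
        | last => exact metric_self_J _
        | cast s =>
          rw [Fin.snoc_last, Fin.snoc_castSucc, J.metric.symm, map_smul, hu2, smul_zero]
      | cast r =>
        induction s using Fin.lastCases with
        | last =>
          rw [Fin.snoc_last, Fin.snoc_castSucc, ← neg_eq_zero, ← metric_J_left, map_smul, hu2,
            smul_zero]
        | cast s => simpa using hv.inner_J r s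

lemma IsUnitaryFamily.linearIndependent {n : ℕ} {v : Fin n → TangentSpace 𝓘(ℝ, E) o}
    (hv : IsUnitaryFamily J v) :
    LinearIndependent ℝ (Sum.elim v fun r ↦ J.J o (v r)) := by
  rw [Fintype.linearIndependent_iff]
  intro a ha
  rw [Fintype.sum_sum_type] at ha
  simp only [Sum.elim_inl, Sum.elim_inr] at ha
  rintro (s | s)
  · have h := congrArg (J.metric.inner o (v s)) ha
    simp only [map_add, map_sum, map_smul, hv.inner, hv.inner_J, map_zero] at h
    simpa using h
  · have h := congrArg (J.metric.inner o (J.J o (v s))) ha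
    simp only [map_add, map_sum, map_smul, metric_J_J, hv.inner,
      J.metric.symm o (J.J o (v s)) (v _), hv.inner_J, map_zero] at h
    simpa using h

/-- There is a smooth field that vanishes at `o` with a given covariant derivative there. -/
lemma exists_field_of_nabla (L : TangentSpace 𝓘(ℝ, E) o →ₗ[ℝ] TangentSpace 𝓘(ℝ, E) o) :
    ∃ Z : Π x : M, TangentSpace 𝓘(ℝ, E) x, CMDiff[(chartAt E o).source] ∞ (T% Z) ∧ Z o = 0 ∧
      ∀ u, nabla Z o u = L u := by
  classical
  let β := Module.finBasis ℝ (TangentSpace 𝓘(ℝ, E) o)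
  -- The field is a sum of f_a X_a, where X_a extends the basis vector β_a and f_a vanishes at o
  -- with differential the a-th coordinate of L.
  have key (s : Finset (Fin (finrank ℝ (TangentSpace 𝓘(ℝ, E) o)))) :
      ∃ Z : Π x : M, TangentSpace 𝓘(ℝ, E) x, CMDiff[(chartAt E o).source] ∞ (T% Z) ∧ Z o = 0 ∧
      ∀ u, nabla Z o u = ∑ a ∈ s, β.coord a (L u) • β a := by
    induction s using Finset.induction_on with
    | empty =>
      exact ⟨fun _ ↦ 0, contMDiffOn_zero_field, rfl, fun u ↦ by simp [nabla_zero]⟩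
    | insert a s ha ih =>
      obtain ⟨Z, hZ, hZ0, hZn⟩ := ih
      obtain ⟨X, hX, hXo⟩ := exists_smooth_extension (β a)
      obtain ⟨f, hf, hf0, hfd⟩ :=
        exists_smooth_function (LinearMap.toContinuousLinearMap (β.coord a ∘ₗ L))
      have hfX : CMDiff[(chartAt E o).source] ∞ (T% (fun x ↦ f x • X x)) := hf.smul_section hX
      have mf : MDiffAt f o := (contMDiffAt_fun_of_chart hf).mdifferentiableAt (by simp)
      have mX := mdiffAt_of_smooth (contMDiffAt_of_chart hX)
      refine ⟨fun x ↦ f x • X x + Z x, hfX.add_section hZ, by simp [hf0, hZ0], fun u ↦ ?_⟩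
      rw [nabla_add nabla (mdiffAt_smul mf mX) (mdiffAt_of_smooth (contMDiffAt_of_chart hZ)),
        nabla_smul_of_eq_zero nabla mf hf0 mX, hZn, Finset.sum_insert ha, hfd, hXo]
      rfl
  obtain ⟨Z, hZ, hZ0, hZn⟩ := key Finset.univ
  exact ⟨Z, hZ, hZ0, fun u ↦ by rw [hZn, ← β.sum_repr (L u)]; simp⟩

/-- Every tangent vector extends to a field whose `(1,0)`-part is parallel at `o` for the
`(1,0)`-part of the connection. -/
lemma exists_parallel_extension (v : TangentSpace 𝓘(ℝ, E) o) :
    ∃ X : Π x : M, TangentSpace 𝓘(ℝ, E) x, CMDiff[(chartAt E o).source] ∞ (T% X) ∧ X o = v ∧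
      ∀ u, nabla (fun x ↦ J.J x (X x)) o u = -J.J o (nabla X o u) := by
  obtain ⟨X, hX, hXo⟩ := exists_smooth_extension v
  have mX := mdiffAt_of_smooth (contMDiffAt_of_chart hX)
  -- For a correction Z with Z(o) = 0 and ∇Z = L, the condition reads ∇(JX) + JL = -J∇X - JL; this
  -- is its solution.
  let L : TangentSpace 𝓘(ℝ, E) o →ₗ[ℝ] TangentSpace 𝓘(ℝ, E) o :=
    (1 / 2 : ℝ) • ((J.J o).toLinearMap ∘ₗ (nabla (fun x ↦ J.J x (X x)) o).toLinearMap
      - (nabla X o).toLinearMap)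
  obtain ⟨Z, hZ, hZ0, hZn⟩ := exists_field_of_nabla (nabla := nabla) L
  have mZ := mdiffAt_of_smooth (contMDiffAt_of_chart hZ)
  refine ⟨fun x ↦ X x + Z x, hX.add_section hZ, by simp [hXo, hZ0], fun u ↦ ?_⟩
  simp only [map_add]
  rw [nabla_add nabla mX mZ, nabla_add nabla (mdiffAt_J J mX) (mdiffAt_J J mZ),
    nabla_J_of_eq_zero mZ hZ0, hZn]
  simp only [L, LinearMap.smul_apply, LinearMap.sub_apply, LinearMap.comp_apply, map_smul, map_sub,
    map_add, ContinuousLinearMap.coe_coe, J.sq]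
  module

variable (J nabla o) in
/-- `y` vanishes to second order at `o` and has second covariant derivative `B` there. -/
structure IsSecondOrder (y : Π x : M, TangentSpace 𝓘(ℝ, E) x)
    (B : TangentSpace 𝓘(ℝ, E) o → TangentSpace 𝓘(ℝ, E) o → TangentSpace 𝓘(ℝ, E) o) : Prop where
  smooth : CMDiff[(chartAt E o).source] ∞ (T% y)
  zero : y o = 0
  nabla_zero (u : TangentSpace 𝓘(ℝ, E) o) : nabla y o u = 0
  nabla_nabla {V : Π x : M, TangentSpace 𝓘(ℝ, E) x} (hV : CMDiffAt ∞ (T% V) o)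
    (u : TangentSpace 𝓘(ℝ, E) o) : nabla (fun x ↦ nabla y x (V x)) o u = B u (V o)
  nabla_nabla_J {V : Π x : M, TangentSpace 𝓘(ℝ, E) x} (hV : CMDiffAt ∞ (T% V) o)
    (u : TangentSpace 𝓘(ℝ, E) o) :
    nabla (fun x ↦ nabla (fun z ↦ J.J z (y z)) x (V x)) o u = J.J o (B u (V o))
  nabla_along {Y : Π x : M, TangentSpace 𝓘(ℝ, E) x} (hY : CMDiffAt ∞ (T% Y) o)
    (u : TangentSpace 𝓘(ℝ, E) o) : nabla (fun x ↦ nabla Y x (y x)) o u = 0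
  nabla_along_J {Y : Π x : M, TangentSpace 𝓘(ℝ, E) x} (hY : CMDiffAt ∞ (T% Y) o)
    (u : TangentSpace 𝓘(ℝ, E) o) : nabla (fun x ↦ nabla Y x (J.J x (y x))) o u = 0

lemma IsSecondOrder.mul_smul (h : IsLeviCivita J.metric nabla)
    (hf₁ : CMDiff[(chartAt E o).source] ∞ f₁) (hf₂ : CMDiff[(chartAt E o).source] ∞ f₂)
    (h₁ : f₁ o = 0) (h₂ : f₂ o = 0) (hX : CMDiff[(chartAt E o).source] ∞ (T% X)) :
    IsSecondOrder J nabla o (fun x ↦ (f₁ x * f₂ x) • X x)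
      (fun u v ↦ (d% f₁ o u * d% f₂ o v + d% f₂ o u * d% f₁ o v) • X o) := by
  have cf₁ := contMDiffAt_fun_of_chart hf₁
  have cf₂ := contMDiffAt_fun_of_chart hf₂
  have cX := contMDiffAt_of_chart hX
  have m₁ : MDiffAt f₁ o := cf₁.mdifferentiableAt (by simp)
  have m₂ : MDiffAt f₂ o := cf₂.mdifferentiableAt (by simp)
  have m : MDiffAt (fun y ↦ f₁ y * f₂ y) o := m₁.mul m₂
  have z : f₁ o * f₂ o = 0 := by rw [h₁, zero_mul]
  have d (u) : d% (fun y ↦ f₁ y * f₂ y) o u = 0 := by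
    rw [mvfderiv_mul_of_eq_zero m₁ h₁ m₂, h₂, zero_mul]
  refine ⟨?_, ?_, fun u ↦ ?_, fun hV u ↦ ?_, fun {V} hV u ↦ ?_, fun {Y} hY u ↦ ?_,
    fun {Y} hY u ↦ ?_⟩
  · exact (hf₁.mul hf₂).smul_section hX
  · simp only [z, zero_smul]
  · rw [nabla_smul_of_eq_zero nabla m z (mdiffAt_of_smooth cX), d, zero_smul]
  · exact h.nabla_nabla_mul_smul cf₁ cf₂ h₁ h₂ cX hV u
  · simp only [map_smul]
    exact h.nabla_nabla_mul_smul cf₁ cf₂ h₁ h₂ (contMDiffAt_J J cX) hV u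
  · simp only [map_smul]
    rw [nabla_smul_of_eq_zero nabla m z (mdiffAt_of_smooth (h.contMDiffAt cX hY)), d, zero_smul]
  · simp only [map_smul]
    rw [nabla_smul_of_eq_zero nabla m z
      (mdiffAt_of_smooth (h.contMDiffAt (contMDiffAt_J J cX) hY)), d, zero_smul]

lemma nabla_nabla_add (h : IsLeviCivita J.metric nabla) (hV : CMDiffAt ∞ (T% V) o)
    (hX : CMDiffAt ∞ (T% X) o) (hY : CMDiffAt ∞ (T% Y) o) (u : TangentSpace 𝓘(ℝ, E) o) :
    nabla (fun x ↦ nabla (fun z ↦ X z + Y z) x (V x)) o u =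
      nabla (fun x ↦ nabla X x (V x)) o u + nabla (fun x ↦ nabla Y x (V x)) o u := by
  have m₁ := mdiffAt_of_smooth (h.contMDiffAt hV hX)
  have m₂ := mdiffAt_of_smooth (h.contMDiffAt hV hY)
  rw [← nabla_add nabla m₁ m₂]
  refine congrArg (fun A : _ →L[ℝ] _ ↦ A u) (nabla_congr nabla (mdiffAt_add m₁ m₂) ?_)
  filter_upwards [eventually_mdiffAt hX, eventually_mdiffAt hY] with x h1 h2
  exact nabla_add nabla h1 h2 _

lemma nabla_nabla_along_add (h : IsLeviCivita J.metric nabla) (hV : CMDiffAt ∞ (T% V) o)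
    (hX : CMDiffAt ∞ (T% X) o) (hY : CMDiffAt ∞ (T% Y) o) (u : TangentSpace 𝓘(ℝ, E) o) :
    nabla (fun x ↦ nabla V x (X x + Y x)) o u =
      nabla (fun x ↦ nabla V x (X x)) o u + nabla (fun x ↦ nabla V x (Y x)) o u := by
  simp only [map_add]
  exact nabla_add nabla (mdiffAt_of_smooth (h.contMDiffAt hX hV))
    (mdiffAt_of_smooth (h.contMDiffAt hY hV)) u

lemma IsSecondOrder.add (h : IsLeviCivita J.metric nabla)
    {y y' : Π x : M, TangentSpace 𝓘(ℝ, E) x}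
    {B B' : TangentSpace 𝓘(ℝ, E) o → TangentSpace 𝓘(ℝ, E) o → TangentSpace 𝓘(ℝ, E) o}
    (hy : IsSecondOrder J nabla o y B) (hy' : IsSecondOrder J nabla o y' B') :
    IsSecondOrder J nabla o (fun x ↦ y x + y' x) (fun u v ↦ B u v + B' u v) := by
  have c := contMDiffAt_of_chart hy.smooth
  have c' := contMDiffAt_of_chart hy'.smooth
  refine ⟨hy.smooth.add_section hy'.smooth, by simp [hy.zero, hy'.zero], fun u ↦ ?_,
    fun hV u ↦ ?_, fun {V} hV u ↦ ?_, fun {Y} hY u ↦ ?_, fun {Y} hY u ↦ ?_⟩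
  · rw [nabla_add nabla (mdiffAt_of_smooth c) (mdiffAt_of_smooth c'), hy.nabla_zero,
      hy'.nabla_zero, add_zero]
  · rw [nabla_nabla_add h hV c c', hy.nabla_nabla hV, hy'.nabla_nabla hV]
  · simp only [map_add]
    rw [nabla_nabla_add h hV (contMDiffAt_J J c) (contMDiffAt_J J c'), hy.nabla_nabla_J hV,
      hy'.nabla_nabla_J hV]
  · rw [nabla_nabla_along_add h hY c c', hy.nabla_along hY, hy'.nabla_along hY, add_zero]
  · simp only [(J.J _).map_add]
    rw [nabla_nabla_along_add h hY (contMDiffAt_J J c) (contMDiffAt_J J c'), hy.nabla_along_J hY,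
      hy'.nabla_along_J hY, add_zero]

lemma isSecondOrder_zero : IsSecondOrder J nabla o (fun _ ↦ 0) (fun _ _ ↦ 0) := by
  refine ⟨contMDiffOn_zero_field, rfl, fun u ↦ ?_,
    fun hV u ↦ ?_, fun {V} hV u ↦ ?_, fun {Y} hY u ↦ ?_, fun {Y} hY u ↦ ?_⟩ <;>
  simp [nabla_zero]

/-- There are fields vanishing to second order at `o` with given second derivative on a basis. -/
lemma exists_isSecondOrder (h : IsLeviCivita J.metric nabla) {ι : Type*} [Fintype ι]
    [DecidableEq ι] (β : Basis ι ℝ (TangentSpace 𝓘(ℝ, E) o)) (w : ι → ι → TangentSpace 𝓘(ℝ, E) o) :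
    ∃ y B, IsSecondOrder J nabla o y B ∧ ∀ a b, B (β a) (β b) = w a b + w b a := by
  -- Sum over index pairs of products of two functions with differentials dual to β, times an
  -- extension of w a b. The Hessian of such a product is symmetric, whence w a b + w b a.
  have key (s : Finset (ι × ι)) : ∃ y, IsSecondOrder J nabla o y (fun u v ↦ ∑ p ∈ s,
      (β.coord p.1 u * β.coord p.2 v + β.coord p.2 u * β.coord p.1 v) • w p.1 p.2) := by
    induction s using Finset.induction_on with
    | empty => exact ⟨_, by simpa using isSecondOrder_zero⟩
    | insert p s hp ih =>
      obtain ⟨y, hy⟩ := ih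
      obtain ⟨X, hX, hXo⟩ := exists_smooth_extension (w p.1 p.2)
      obtain ⟨f₁, hf₁, h₁, d₁⟩ :=
        exists_smooth_function (LinearMap.toContinuousLinearMap (β.coord p.1))
      obtain ⟨f₂, hf₂, h₂, d₂⟩ :=
        exists_smooth_function (LinearMap.toContinuousLinearMap (β.coord p.2))
      have := (IsSecondOrder.mul_smul h hf₁ hf₂ h₁ h₂ hX).add h hy
      rw [d₁, d₂, hXo] at this
      exact ⟨_, by simpa only [Finset.sum_insert hp] using! this⟩
  obtain ⟨y, hy⟩ := key Finset.univ
  refine ⟨y, _, hy, fun a b ↦ ?_⟩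
  simp only [add_smul, Finset.sum_add_distrib, Fintype.sum_prod_type, Basis.coord_apply,
    Basis.repr_self, Finsupp.single_apply]
  simp [Finset.sum_ite_eq]

variable (J nabla) in
/-- The real part of `∇_{X + iJX} (Y - iJY)`. -/
def mixedNabla (X Y : Π x : M, TangentSpace 𝓘(ℝ, E) x) (x : M) : TangentSpace 𝓘(ℝ, E) x :=
  nabla Y x (X x) + nabla (fun z ↦ J.J z (Y z)) x (J.J x (X x))

lemma contMDiffAt_mixedNabla (h : IsLeviCivita J.metric nabla) (hX : CMDiffAt ∞ (T% X) o)
    (hY : CMDiffAt ∞ (T% Y) o) : CMDiffAt ∞ (T% (mixedNabla J nabla X Y)) o :=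
  (h.contMDiffAt hX hY).add_section (h.contMDiffAt (contMDiffAt_J J hX) (contMDiffAt_J J hY))

/-- Perturbing the direction field by `x` has no effect at this order, since ∇_x Y has zero
derivative at o. Only the Hessian B of the perturbation of the differentiated field enters. -/
lemma nabla_mixedNabla_add (h : IsLeviCivita J.metric nabla) (hX : CMDiffAt ∞ (T% X) o)
    (hY : CMDiffAt ∞ (T% Y) o) {x y : Π x : M, TangentSpace 𝓘(ℝ, E) x}
    {A B : TangentSpace 𝓘(ℝ, E) o → TangentSpace 𝓘(ℝ, E) o → TangentSpace 𝓘(ℝ, E) o}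
    (hx : IsSecondOrder J nabla o x A) (hy : IsSecondOrder J nabla o y B)
    (u : TangentSpace 𝓘(ℝ, E) o) :
    nabla (mixedNabla J nabla (fun z ↦ X z + x z) (fun z ↦ Y z + y z)) o u =
      nabla (mixedNabla J nabla X Y) o u + (B u (X o) + J.J o (B u (J.J o (X o)))) := by
  have cx := contMDiffAt_of_chart hx.smooth
  have cy := contMDiffAt_of_chart hy.smooth
  have cXx : CMDiffAt ∞ (T% (fun z ↦ X z + x z)) o := hX.add_section cx
  have cYy : CMDiffAt ∞ (T% (fun z ↦ Y z + y z)) o := hY.add_section cy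
  have jX := contMDiffAt_J J hX
  have jY := contMDiffAt_J J hY
  have jx := contMDiffAt_J J cx
  have jy := contMDiffAt_J J cy
  have split {P Q : Π x : M, TangentSpace 𝓘(ℝ, E) x} (hP : CMDiffAt ∞ (T% P) o)
      (hQ : CMDiffAt ∞ (T% Q) o) : nabla (mixedNabla J nabla P Q) o u =
      nabla (fun z ↦ nabla Q z (P z)) o u +
        nabla (fun z ↦ nabla (fun z ↦ J.J z (Q z)) z (J.J z (P z))) o u :=
    nabla_add nabla (mdiffAt_of_smooth (h.contMDiffAt hP hQ))
      (mdiffAt_of_smooth (h.contMDiffAt (contMDiffAt_J J hP) (contMDiffAt_J J hQ))) u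
  rw [split cXx cYy, split hX hY, nabla_nabla_along_add h cYy hX cx, hx.nabla_along cYy,
    nabla_nabla_add h hX hY cy, hy.nabla_nabla hX]
  have jYy := contMDiffAt_J J cYy
  simp only [(J.J _).map_add] at jYy ⊢
  rw [nabla_nabla_along_add h jYy jX jx, hx.nabla_along_J jYy, nabla_nabla_add h jX jY jy,
    hy.nabla_nabla_J jX]
  abel

/-- The real form of the theorem: real parts of the wanted `(1,0)`-fields. -/
lemma exists_adapted_fields (h : IsLeviCivita J.metric nabla) {n : ℕ}
    (hE : finrank ℝ E = 2 * n) {v : Fin n → TangentSpace 𝓘(ℝ, E) o} (hv : IsUnitaryFamily J v) :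
    ∃ e : Fin n → Π x : M, TangentSpace 𝓘(ℝ, E) x,
      (∀ i, CMDiff[(chartAt E o).source] ∞ (T% (e i))) ∧ (∀ i, e i o = v i) ∧
      (∀ i u, nabla (fun x ↦ J.J x (e i x)) o u = -J.J o (nabla (e i) o u)) ∧
      ∀ r k i, nabla (mixedNabla J nabla (e k) (e i)) o (v r) =
        J.J o (nabla (mixedNabla J nabla (e k) (e i)) o (J.J o (v r))) := by
  choose X hX hXo hXn using fun i ↦ exists_parallel_extension (J := J) (nabla := nabla) (v i)
  have hfr : Fintype.card (Fin n ⊕ Fin n) = finrank ℝ (TangentSpace 𝓘(ℝ, E) o) := by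
    change _ = finrank ℝ E
    simp [hE, two_mul]
  let β : Basis (Fin n ⊕ Fin n) ℝ (TangentSpace 𝓘(ℝ, E) o) :=
    Basis.mk hv.linearIndependent
      (hv.linearIndependent.span_eq_top_of_card_eq_finrank' hfr).ge
  have hβl (r) : β (.inl r) = v r := by simp [β]
  have hβr (r) : β (.inr r) = J.J o (v r) := by simp [β]
  -- The defect of the uncorrected fields in the last condition. The correction must make B(v_r,
  -- v_k) + J B(v_r, Jv_k) - J B(Jv_r, v_k) + B(Jv_r, Jv_k) equal to it.
  let c (i k r : Fin n) : TangentSpace 𝓘(ℝ, E) o :=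
    J.J o (nabla (mixedNabla J nabla (X k) (X i)) o (J.J o (v r)))
      - nabla (mixedNabla J nabla (X k) (X i)) o (v r)
  -- Real form of the quadratic term z_r z̄_k with coefficient c i k r. Symmetrizing adds terms in c
  -- i r k, but these cancel in the required combination, while the four copies of c i k r / 4 add
  -- up; c need not be symmetric.
  let w (i : Fin n) : Fin n ⊕ Fin n → Fin n ⊕ Fin n → TangentSpace 𝓘(ℝ, E) o
    | .inl r, .inl k => (1 / 4 : ℝ) • c i k r
    | .inr r, .inr k => (1 / 4 : ℝ) • c i k r
    | .inr r, .inl k => (1 / 4 : ℝ) • J.J o (c i k r)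
    | .inl r, .inr k => -(1 / 4 : ℝ) • J.J o (c i k r)
  choose y B hy hB using fun i ↦ exists_isSecondOrder h β (w i)
  have cX (i) := contMDiffAt_of_chart (hX i)
  have my (i) := mdiffAt_of_smooth (contMDiffAt_of_chart (hy i).smooth)
  refine ⟨fun i x ↦ X i x + y i x, fun i ↦ (hX i).add_section (hy i).smooth,
    fun i ↦ by simp [hXo, (hy i).zero], fun i u ↦ ?_, fun r k i ↦ ?_⟩
  · simp only [map_add]
    rw [nabla_add nabla (mdiffAt_of_smooth (cX i)) (my i),
      nabla_add nabla (mdiffAt_J J (mdiffAt_of_smooth (cX i))) (mdiffAt_J J (my i)),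
      nabla_J_of_eq_zero (my i) (hy i).zero, (hy i).nabla_zero, hXn]
    simp
  · rw [nabla_mixedNabla_add h (cX k) (cX i) (hy k) (hy i),
      nabla_mixedNabla_add h (cX k) (cX i) (hy k) (hy i), hXo]
    have h1 := hB i (.inl r) (.inl k)
    have h2 := hB i (.inl r) (.inr k)
    have h3 := hB i (.inr r) (.inl k)
    have h4 := hB i (.inr r) (.inr k)
    simp only [hβl, hβr, w] at h1 h2 h3 h4
    rw [h1, h2, h3, h4]
    simp only [map_add, map_smul, map_neg, J.sq, c, map_sub]
    module

end AdaptedFields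
-- Translation between real fields and (1,0)-fields
section ComplexFields

section Algebra

variable {V : Type*} [AddCommGroup V] [Module ℝ V]

@[simp] lemma cxRe_tmul (z : ℂ) (v : V) : cxRe (z ⊗ₜ[ℝ] v) = z.re • v := by simp [cxRe]

@[simp] lemma cxIm_tmul (z : ℂ) (v : V) : cxIm (z ⊗ₜ[ℝ] v) = z.im • v := by simp [cxIm]

@[simp] lemma cxConj_tmul (z : ℂ) (v : V) :
    cxConj (z ⊗ₜ[ℝ] v) = (starRingEnd ℂ z) ⊗ₜ[ℝ] v := by simp [cxConj]

lemma tmul_eq_re_add_im (z : ℂ) (v : V) :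
    z ⊗ₜ[ℝ] v = (1 : ℂ) ⊗ₜ[ℝ] (z.re • v) + Complex.I ⊗ₜ[ℝ] (z.im • v) := by
  rw [← TensorProduct.smul_tmul, ← TensorProduct.smul_tmul, ← TensorProduct.add_tmul]
  congr 1
  simp [Complex.re_add_im]

lemma eq_cxRe_add_cxIm (w : ℂ ⊗[ℝ] V) :
    w = (1 : ℂ) ⊗ₜ[ℝ] cxRe w + Complex.I ⊗ₜ[ℝ] cxIm w := by
  induction w using TensorProduct.induction_on with
  | zero => simp
  | tmul z v => simpa using tmul_eq_re_add_im z v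
  | add x y hx hy =>
    rw [map_add, map_add, TensorProduct.tmul_add, TensorProduct.tmul_add]
    nth_rw 1 [hx, hy]
    abel

lemma ofReal_smul_tensor (r : ℝ) (w : ℂ ⊗[ℝ] V) : (r : ℂ) • w = r • w := algebraMap_smul ℂ r w

end Algebra

variable {E : Type*} [NormedAddCommGroup E] [NormedSpace ℝ E]
  {M : Type*} [TopologicalSpace M] [ChartedSpace E M] [IsManifold 𝓘(ℝ, E) ∞ M]
  {κ : SymplecticForm E M} {J : CalibratedStructure κ}
  {nabla : CovariantDerivative 𝓘(ℝ, E) E (fun x : M ↦ TangentSpace 𝓘(ℝ, E) x)}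
  {X Y : Π x : M, TangentSpace 𝓘(ℝ, E) x} {x o : M}

lemma cxNabla_apply (W : Π x : M, CTangent E x) (a b : TangentSpace 𝓘(ℝ, E) x) :
    cxNabla nabla W x ((1 : ℂ) ⊗ₜ[ℝ] a + Complex.I ⊗ₜ[ℝ] b) =
      (1 : ℂ) ⊗ₜ[ℝ] (nabla (fun y ↦ cxRe (W y)) x a - nabla (fun y ↦ cxIm (W y)) x b) +
      Complex.I ⊗ₜ[ℝ] (nabla (fun y ↦ cxRe (W y)) x b + nabla (fun y ↦ cxIm (W y)) x a) := by
  simp only [cxNabla, LinearMap.add_apply, LinearMap.smul_apply, map_add,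
    LinearMap.baseChange_tmul, ContinuousLinearMap.coe_coe, TensorProduct.smul_tmul',
    smul_eq_mul, Complex.I_mul_I, mul_one, TensorProduct.tmul_add, TensorProduct.tmul_sub,
    TensorProduct.neg_tmul]
  abel

lemma tmul_add_mem_T01 {p q : TangentSpace 𝓘(ℝ, E) x} (h : q = J.J x p) :
    (1 : ℂ) ⊗ₜ[ℝ] p + Complex.I ⊗ₜ[ℝ] q ∈ T01 J x := by
  subst h
  rw [T01, End.mem_eigenspace_iff]
  simp only [map_add, LinearMap.baseChange_tmul, ContinuousLinearMap.coe_coe, J.sq, smul_add,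
    TensorProduct.smul_tmul', smul_eq_mul, neg_mul, Complex.I_mul_I, mul_one,
    TensorProduct.tmul_neg, TensorProduct.neg_tmul, neg_neg]
  abel

variable (J x) in
/-- The `(1,0)`-vector `v - iJv`. -/
def holo : TangentSpace 𝓘(ℝ, E) x →ₗ[ℝ] CTangent E x :=
  TensorProduct.mk ℝ ℂ _ 1 - TensorProduct.mk ℝ ℂ _ Complex.I ∘ₗ (J.J x).toLinearMap

lemma holo_apply (v : TangentSpace 𝓘(ℝ, E) x) :
    holo J x v = (1 : ℂ) ⊗ₜ[ℝ] v + Complex.I ⊗ₜ[ℝ] (-J.J x v) := by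
  rw [TensorProduct.tmul_neg, ← sub_eq_add_neg]; rfl

lemma cxConj_holo (v : TangentSpace 𝓘(ℝ, E) x) :
    cxConj (holo J x v) = (1 : ℂ) ⊗ₜ[ℝ] v + Complex.I ⊗ₜ[ℝ] J.J x v := by
  rw [holo_apply, map_add, cxConj_tmul, cxConj_tmul]
  simp [TensorProduct.neg_tmul, TensorProduct.tmul_neg]

@[simp] lemma cxRe_holo (v : TangentSpace 𝓘(ℝ, E) x) : cxRe (holo J x v) = v := by
  simp [holo_apply]

@[simp] lemma cxIm_holo (v : TangentSpace 𝓘(ℝ, E) x) : cxIm (holo J x v) = -J.J x v := by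
  simp [holo_apply]

@[simp] lemma cxRe_cxConj_holo (v : TangentSpace 𝓘(ℝ, E) x) :
    cxRe (cxConj (holo J x v)) = v := by
  simp [cxConj_holo]

@[simp] lemma cxIm_cxConj_holo (v : TangentSpace 𝓘(ℝ, E) x) :
    cxIm (cxConj (holo J x v)) = J.J x v := by
  simp [cxConj_holo]

lemma holo_J (v : TangentSpace 𝓘(ℝ, E) x) : holo J x (J.J x v) = Complex.I • holo J x v := by
  simp only [holo_apply, J.sq, neg_neg, smul_add, smul_neg, TensorProduct.smul_tmul', smul_eq_mul,
    mul_one, Complex.I_mul_I, TensorProduct.tmul_neg, TensorProduct.neg_tmul]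
  abel

lemma holo_mem_T10 (v : TangentSpace 𝓘(ℝ, E) x) : holo J x v ∈ T10 J x := by
  rw [T10, End.mem_eigenspace_iff, ← holo_J, holo_apply, holo_apply]
  simp only [map_add, LinearMap.baseChange_tmul, ContinuousLinearMap.coe_coe, map_neg]

lemma eq_holo_of_mem_T10 {z : CTangent E x} (hz : z ∈ T10 J x) : z = holo J x (cxRe z) := by
  rw [T10, End.mem_eigenspace_iff] at hz
  have h := congrArg cxRe hz
  rw [eq_cxRe_add_cxIm z] at h
  simp only [map_add, LinearMap.baseChange_tmul, ContinuousLinearMap.coe_coe, smul_add,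
    TensorProduct.smul_tmul', smul_eq_mul, mul_one, Complex.I_mul_I, cxRe_tmul] at h
  simp only [Complex.one_re, Complex.I_re, one_smul, zero_smul, add_zero, zero_add,
    Complex.neg_re, neg_smul] at h
  conv_lhs => rw [eq_cxRe_add_cxIm z]
  rw [holo_apply, h, neg_neg]

lemma re_smul_add_im_smul_holo (z : ℂ) (v : TangentSpace 𝓘(ℝ, E) x) :
    holo J x (z.re • v + z.im • J.J x v) = z • holo J x v := by
  rw [map_add, map_smul, map_smul, holo_J]
  conv_rhs => rw [← Complex.re_add_im z, add_smul, mul_smul]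
  rw [ofReal_smul_tensor, ofReal_smul_tensor]

lemma linearIndependent_holo {n : ℕ} {e : Fin n → TangentSpace 𝓘(ℝ, E) x}
    (he : LinearIndependent ℝ (Sum.elim e fun r ↦ J.J x (e r))) :
    LinearIndependent ℂ (fun i ↦ holo J x (e i)) := by
  rw [Fintype.linearIndependent_iff] at he ⊢
  intro c hc
  have h := congrArg cxRe hc
  simp only [← re_smul_add_im_smul_holo, map_sum, cxRe_holo, map_zero,
    Finset.sum_add_distrib] at h
  have h' := he (Sum.elim (fun i ↦ (c i).re) (fun i ↦ (c i).im))
    (by rw [Fintype.sum_sum_type]; exact h)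
  exact fun i ↦ Complex.ext (h' (.inl i)) (h' (.inr i))

/-- `holo` maps onto T^{(1,0)} and turns J into multiplication by i, so a real span of the e_r and
Je_r becomes a complex span. -/
lemma span_holo {n : ℕ} {e : Fin n → TangentSpace 𝓘(ℝ, E) x}
    (he : Submodule.span ℝ (Set.range (Sum.elim e fun r ↦ J.J x (e r))) = ⊤) :
    Submodule.span ℂ (Set.range fun i ↦ holo J x (e i)) = T10 J x := by
  refine le_antisymm (Submodule.span_le.2 ?_) fun z hz ↦ ?_
  · rintro _ ⟨i, rfl⟩
    exact holo_mem_T10 _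
  · rw [eq_holo_of_mem_T10 hz]
    have hmem : cxRe z ∈ Submodule.span ℝ (Set.range (Sum.elim e fun r ↦ J.J x (e r))) := by
      rw [he]; trivial
    generalize cxRe z = a at hmem
    induction hmem using Submodule.span_induction with
    | mem v hv =>
      obtain ⟨i | i, rfl⟩ := hv
      · exact Submodule.subset_span ⟨i, rfl⟩
      · simp only [Sum.elim_inr, holo_J]
        exact Submodule.smul_mem _ _ (Submodule.subset_span ⟨i, rfl⟩)
    | zero => simp
    | add v w _ _ hv hw => rw [map_add]; exact Submodule.add_mem _ hv hw
    | smul a v _ hv =>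
      rw [map_smul, ← ofReal_smul_tensor]
      exact Submodule.smul_mem _ _ hv

variable [FiniteDimensional ℝ E]

lemma cxMetric_holo (v w : TangentSpace 𝓘(ℝ, E) x) :
    cxMetric J.metric x (holo J x v) (cxConj (holo J x w)) =
      ((2 * J.metric.inner x v w : ℝ) : ℂ)
        + Complex.I * ((2 * J.metric.inner x v (J.J x w) : ℝ) : ℂ) := by
  have h (a b : ℂ) (p q : TangentSpace 𝓘(ℝ, E) x) :
      cxMetric J.metric x (a ⊗ₜ[ℝ] p) (b ⊗ₜ[ℝ] q) = a * b * (J.metric.inner x p q : ℝ) := by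
    simp [cxMetric, mul_comm]
  rw [holo_apply, cxConj_holo]
  simp only [map_add, LinearMap.add_apply, h]
  have h1 := metric_J_left J v w
  have h2 := metric_J_J J v w
  have h3 : J.metric.inner x (-J.J x v) w = J.metric.inner x v (J.J x w) := by
    rw [map_neg, neg_apply, h1, neg_neg]
  have h4 : J.metric.inner x (-J.J x v) (J.J x w) = -J.metric.inner x v w := by
    rw [map_neg, neg_apply, h2]
  rw [h3, h4]
  push_cast
  linear_combination (-(J.metric.inner x v w : ℂ)) * Complex.I_mul_I

lemma cxNabla_holo (hX : MDiffAt (T% X) x) (a b : TangentSpace 𝓘(ℝ, E) x) :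
    cxNabla nabla (fun y ↦ holo J y (X y)) x ((1 : ℂ) ⊗ₜ[ℝ] a + Complex.I ⊗ₜ[ℝ] b) =
      (1 : ℂ) ⊗ₜ[ℝ] (nabla X x a + nabla (fun y ↦ J.J y (X y)) x b) +
      Complex.I ⊗ₜ[ℝ] (nabla X x b - nabla (fun y ↦ J.J y (X y)) x a) := by
  rw [cxNabla_apply]
  simp only [cxRe_holo, cxIm_holo, nabla_neg nabla (mdiffAt_J J hX)]
  rw [sub_neg_eq_add, ← sub_eq_add_neg]

lemma cxNabla_conj_holo (a b : TangentSpace 𝓘(ℝ, E) x) :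
    cxNabla nabla (fun y ↦ cxConj (holo J y (X y))) x ((1 : ℂ) ⊗ₜ[ℝ] a + Complex.I ⊗ₜ[ℝ] b) =
      (1 : ℂ) ⊗ₜ[ℝ] (nabla X x a - nabla (fun y ↦ J.J y (X y)) x b) +
      Complex.I ⊗ₜ[ℝ] (nabla X x b + nabla (fun y ↦ J.J y (X y)) x a) := by
  rw [cxNabla_apply]
  simp only [cxRe_cxConj_holo, cxIm_cxConj_holo]

/-- The derivative of Y - iJY along X + iJX is of type (1,0) by the almost Kähler identity and of
type (0,1) at o by `hp`, hence zero. -/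
lemma mixedNabla_eq_zero (h : IsLeviCivita J.metric nabla) (hY : CMDiffAt ∞ (T% Y) o)
    (hp : ∀ u, nabla (fun x ↦ J.J x (Y x)) o u = -J.J o (nabla Y o u)) :
    mixedNabla J nabla X Y o = 0 := by
  have h1 := nabla_add_nabla_J h hY (X o)
  simp only [mixedNabla, hp] at h1 ⊢
  set a := nabla Y o (X o)
  set b := nabla Y o (J.J o (X o))
  simp only [map_add, map_neg, J.sq, neg_neg] at h1
  have h2 : b = -J.J o a := by
    have h3 : (2 : ℝ) • (b + J.J o a) = 0 := by
      have : -J.J o a - b - (J.J o a + b) = 0 := sub_eq_zero.2 h1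
      rw [← neg_eq_zero, ← this]
      module
    exact eq_neg_of_add_eq_zero_left ((smul_eq_zero.1 h3).resolve_left two_ne_zero)
  rw [h2, map_neg, J.sq]
  simp

/-- Since g(X, Y) = g(JX, JY), its differential can be computed both ways; the hypotheses make the
second result the negative of the first. -/
lemma mvfderiv_metric_eq_zero (h : IsLeviCivita J.metric nabla) (hX : MDiffAt (T% X) o)
    (hY : MDiffAt (T% Y) o)
    (hpX : ∀ u, nabla (fun x ↦ J.J x (X x)) o u = -J.J o (nabla X o u))
    (hpY : ∀ u, nabla (fun x ↦ J.J x (Y x)) o u = -J.J o (nabla Y o u)) :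
    d% (fun y ↦ J.metric.inner y (X y) (Y y)) o = 0 := by
  ext u
  have h1 := h.metric u hX hY
  have h2 := h.metric u (mdiffAt_J J hX) (mdiffAt_J J hY)
  simp only [metric_J_J, hpX, hpY, map_neg, neg_apply] at h2
  simp only [zero_apply]
  linarith

/-- The field JY satisfies the same condition at o as Y. -/
lemma mvfderiv_metric_J_eq_zero (h : IsLeviCivita J.metric nabla) (hX : MDiffAt (T% X) o)
    (hY : MDiffAt (T% Y) o)
    (hpX : ∀ u, nabla (fun x ↦ J.J x (X x)) o u = -J.J o (nabla X o u))
    (hpY : ∀ u, nabla (fun x ↦ J.J x (Y x)) o u = -J.J o (nabla Y o u)) :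
    d% (fun y ↦ J.metric.inner y (X y) (J.J y (Y y))) o = 0 := by
  refine mvfderiv_metric_eq_zero h hX (mdiffAt_J J hY) hpX fun u ↦ ?_
  simp only [J.sq, nabla_neg nabla hY, hpY, map_neg, neg_neg]

lemma hasMFDerivAt_zero_of_eq {G : M → ℂ}
    {G' : TangentSpace 𝓘(ℝ, E) o →L[ℝ] TangentSpace 𝓘(ℝ, ℂ) (G o)}
    (h : HasMFDerivAt 𝓘(ℝ, E) 𝓘(ℝ, ℂ) G o G') (h0 : G' = 0) :
    HasMFDerivAt 𝓘(ℝ, E) 𝓘(ℝ, ℂ) G o 0 :=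
  h0 ▸ h

lemma hasMFDerivAt_cxMetric_holo (h : IsLeviCivita J.metric nabla) (hX : MDiffAt (T% X) o)
    (hY : MDiffAt (T% Y) o)
    (hpX : ∀ u, nabla (fun x ↦ J.J x (X x)) o u = -J.J o (nabla X o u))
    (hpY : ∀ u, nabla (fun x ↦ J.J x (Y x)) o u = -J.J o (nabla Y o u)) :
    HasMFDerivAt 𝓘(ℝ, E) 𝓘(ℝ, ℂ)
      (fun x ↦ cxMetric J.metric x (holo J x (X x)) (cxConj (holo J x (Y x)))) o 0 := by
  have key {f : M → ℝ} (hf : MDiffAt f o) (hf0 : d% f o = 0) :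
      HasMFDerivAt 𝓘(ℝ, E) 𝓘(ℝ, ℝ) f o 0 := by
    have h1 := hf.hasMFDerivAt
    have h2 : mfderiv 𝓘(ℝ, E) 𝓘(ℝ, ℝ) f o = 0 := hf0
    rwa [h2] at h1
  have ha := key (mdiffAt_metric J.metric hX hY) (mvfderiv_metric_eq_zero h hX hY hpX hpY)
  have hb := key (mdiffAt_metric J.metric hX (mdiffAt_J J hY))
    (mvfderiv_metric_J_eq_zero h hX hY hpX hpY)
  have comp (L : ℝ →L[ℝ] ℂ) {f : M → ℝ} (hf : HasMFDerivAt 𝓘(ℝ, E) 𝓘(ℝ, ℝ) f o 0) :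
      HasMFDerivAt 𝓘(ℝ, E) 𝓘(ℝ, ℂ) (L ∘ f) o 0 :=
    hasMFDerivAt_zero_of_eq (HasMFDerivAt.comp o L.hasMFDerivAt hf)
      (ContinuousLinearMap.ext fun _ ↦ L.map_zero)
  have hAB := hasMFDerivAt_zero_of_eq ((comp ((2 : ℝ) • Complex.ofRealCLM) ha).add
    (comp ((2 * Complex.I) • Complex.ofRealCLM) hb)) (add_zero (0 : E →L[ℝ] ℂ))
  refine hAB.congr_of_eventuallyEq (.of_forall fun y ↦ ?_)
  refine (cxMetric_holo (X y) (Y y)).trans ?_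
  simp
  ring

/-- Linear independence of a family of smooth fields is an open condition. -/
lemma eventually_linearIndependent {ι : Type*} [Finite ι]
    {F : ι → Π x : M, TangentSpace 𝓘(ℝ, E) x} (hF : ∀ i, CMDiffAt ∞ (T% (F i)) o)
    (h : LinearIndependent ℝ (fun i ↦ F i o)) :
    ∀ᶠ x in nhds o, LinearIndependent ℝ (fun i ↦ F i x) := by
  let t := trivializationAt E (TangentSpace 𝓘(ℝ, E) (M := M)) o
  have ho : o ∈ t.baseSet := FiberBundle.mem_baseSet_trivializationAt' o
  have hc : ContinuousAt (fun x i ↦ (t ⟨x, F i x⟩).2) o :=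
    continuousAt_pi.2 fun i ↦ ((contMDiffAt_section _).1 (hF i)).continuousAt
  have hcoe {x : M} (hx : x ∈ t.baseSet) : (fun i ↦ (t ⟨x, F i x⟩).2) =
      (t.continuousLinearEquivAt ℝ x hx).toLinearEquiv.toLinearMap ∘ fun i ↦ F i x := by
    ext i; rfl
  have hlo : LinearIndependent ℝ (fun i ↦ (t ⟨o, F i o⟩).2) := by
    rw [hcoe ho]
    exact h.map' _ (LinearEquiv.ker _)
  have hev := hc.eventually hlo.eventually
  filter_upwards [hev, t.open_baseSet.mem_nhds ho] with x hx hxt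
  rw [hcoe hxt] at hx
  exact hx.of_comp _

end ComplexFields
end
end AlmostKahler

/-! ### Assembly of the frame -/

open AlmostKahler
theorem theorem1 {n : ℕ} {E : Type*} [NormedAddCommGroup E] [NormedSpace ℝ E]
    [FiniteDimensional ℝ E] (hE : Module.finrank ℝ E = 2 * n)
    {M : Type*} [TopologicalSpace M] [ChartedSpace E M] [IsManifold 𝓘(ℝ, E) ∞ M]
    (κ : SymplecticForm E M) (J : CalibratedStructure κ) (o : M) :
    ∃ (U : Set M) (W : Fin n → Π x : M, CTangent E x),
      IsOpen U ∧ o ∈ U ∧ IsFrame10 J W U ∧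
      (∀ k i, cxNabla (leviCivita J.metric) (fun x ↦ cxConj (W i x)) o (W k o) = 0) ∧
      (∀ k i, cxNabla (leviCivita J.metric) (W i) o (W k o) ∈ T01 J o) ∧
      (∀ r s, cxMetric J.metric o (W r o) (cxConj (W s o)) = if r = s then 1 else 0) ∧
      (∀ r s, HasMFDerivAt 𝓘(ℝ, E) 𝓘(ℝ, ℂ)
        (fun x ↦ cxMetric J.metric x (W r x) (cxConj (W s x))) o 0) ∧
      (∀ r k i, cxNabla (leviCivita J.metric)
        (fun x ↦ cxNabla (leviCivita J.metric) (W i) x (cxConj (W k x))) o (W r o) = 0) := by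
  have hLC := isLeviCivita_leviCivita J.metric
  set nabla := leviCivita J.metric
  obtain ⟨v, hv⟩ := exists_isUnitaryFamily J o hE n le_rfl
  obtain ⟨e, he, heo, hpar, hmix⟩ := exists_adapted_fields hLC hE hv
  have ce (i) := contMDiffAt_of_chart (he i)
  have me (i) := mdiffAt_of_smooth (ce i)
  have hind := eventually_linearIndependent
    (F := Sum.elim e fun i x ↦ J.J x (e i x)) (o := o)
    (by rintro (i | i); exacts [ce i, contMDiffAt_J J (ce i)])
    (by
      convert! hv.linearIndependent using 1
      ext (i | i) <;> simp [heo])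
  -- On `U₁` the e_i and Je_i are independent over ℝ; by the dimension count they span, which gives
  -- the complex frame.
  obtain ⟨U₁, hU₁, hU₁o, hoU₁⟩ := eventually_nhds_iff.1 hind
  have hmixo (k i) : mixedNabla J nabla (e k) (e i) o = 0 :=
    mixedNabla_eq_zero hLC (ce i) (hpar i)
  refine ⟨(chartAt E o).source ∩ U₁, fun i x ↦ holo J x (e i x),
    (chartAt E o).open_source.inter hU₁o, ⟨mem_chart_source E o, hoU₁⟩, ⟨fun i ↦ ?_, fun x hx ↦ ?_,
    fun x hx ↦ ?_⟩, fun k i ↦ ?_, fun k i ↦ ?_, fun r s ↦ ?_, fun r s ↦ ?_, fun r k i ↦ ?_⟩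
  · refine ⟨?_, ?_⟩
    · simp only [cxRe_holo]
      exact (he i).mono Set.inter_subset_left
    · simp only [cxIm_holo]
      exact ((contMDiffOn_J J (he i)).neg_section).mono Set.inter_subset_left
  · refine linearIndependent_holo ?_
    convert! hU₁ x hx.2 using 1
    ext (j | j) <;> rfl
  · refine span_holo ?_
    have hli : LinearIndependent ℝ (Sum.elim (fun i ↦ e i x) fun i ↦ J.J x (e i x)) := by
      convert! hU₁ x hx.2 using 1
      ext (j | j) <;> rfl
    refine hli.span_eq_top_of_card_eq_finrank' ?_
    change _ = Module.finrank ℝ E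
    simp [hE, two_mul]
  · change cxNabla nabla (fun x ↦ cxConj (holo J x (e i x))) o (holo J o (e k o)) = 0
    rw [holo_apply, cxNabla_conj_holo]
    have h1 := hmixo k i
    have h2 := nabla_add_nabla_J hLC (ce i) (e k o)
    rw [mixedNabla] at h1
    rw [h1, map_zero] at h2
    rw [map_neg, map_neg, sub_neg_eq_add, h1, neg_add_eq_sub, h2]
    simp
  · change cxNabla nabla (fun x ↦ holo J x (e i x)) o (holo J o (e k o)) ∈ _
    rw [holo_apply, cxNabla_holo (me i)]
    refine tmul_add_mem_T01 ?_
    simp only [hpar, map_neg, map_add, J.sq]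
    abel
  · rw [cxMetric_holo, heo, heo, hv.inner, hv.inner_J]
    split_ifs <;> simp
  · exact hasMFDerivAt_cxMetric_holo hLC (me r) (me s) (hpar r) (hpar s)
  · set s := mixedNabla J nabla (e k) (e i)
    have cs : CMDiffAt ∞ (T% s) o := contMDiffAt_mixedNabla hLC (ce k) (ce i)
    have ms := mdiffAt_of_smooth cs
    have mns := mdiffAt_of_smooth (contMDiffAt_J J cs).neg_section
    -- The type (1,0) statement is needed on a neighbourhood of o, because this field is
    -- differentiated once more.
    have hS : ∀ᶠ x in nhds o,
        cxNabla nabla (fun y ↦ holo J y (e i y)) x (cxConj (holo J x (e k x))) =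
          holo J x (s x) := by
      filter_upwards [(chartAt E o).open_source.mem_nhds (mem_chart_source E o)] with x hx
      have cx : CMDiffAt ∞ (T% (e i)) x :=
        (he i).contMDiffAt ((chartAt E o).open_source.mem_nhds hx)
      rw [cxConj_holo, cxNabla_holo (mdiffAt_of_smooth cx), holo_apply,
        ← neg_sub, nabla_add_nabla_J hLC cx]
      rfl
    have hre := nabla_congr nabla ms (X := fun x ↦ cxRe
      (cxNabla nabla (fun y ↦ holo J y (e i y)) x (cxConj (holo J x (e k x)))))
      (hS.mono fun x hx ↦ by rw [hx, cxRe_holo])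
    have him := nabla_congr nabla mns (X := fun x ↦ cxIm
      (cxNabla nabla (fun y ↦ holo J y (e i y)) x (cxConj (holo J x (e k x)))))
      (hS.mono fun x hx ↦ by rw [hx, cxIm_holo]; rfl)
    change cxNabla nabla (fun x ↦ cxNabla nabla (fun y ↦ holo J y (e i y)) x
      (cxConj (holo J x (e k x)))) o (holo J o (e r o)) = 0
    rw [holo_apply, cxNabla_apply, hre, him]
    change (1 : ℂ) ⊗ₜ[ℝ] (_ - nabla (fun x ↦ -J.J x (s x)) o _) +
      Complex.I ⊗ₜ[ℝ] (_ + nabla (fun x ↦ -J.J x (s x)) o _) = 0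
    -- Since s(o) = 0, J passes through ∇; what remains is the equation supplied by `hmix`.
    rw [nabla_neg nabla (mdiffAt_J J ms), nabla_neg nabla (mdiffAt_J J ms),
      nabla_J_of_eq_zero ms (hmixo k i), nabla_J_of_eq_zero ms (hmixo k i), heo]
    have h1 : nabla s o (v r) = J.J o (nabla s o (J.J o (v r))) := hmix r k i
    simp only [map_neg, h1, J.sq]
    simp
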